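/- Let $\omega=\omega_1\omega_2\ldots$ be a sequence in $\{0,1,2\}^\infty$ without repetition, i.e. $\omega_i\neq\omega_{i+1}$ for every $i$. Let $G_\omega$ be the Grigorchuk group: the group of automorphisms of the infinite binary rooted tree generated by $a,b_\omega,c_\omega,d_\omega$, where, for all binary words $x$, \[ a(0x)=1x,\qquad a(1x)=0x,\qquad s_\omega(1x)=1\,s_{\sigma\omega}(x),\qquad s_\omega(0x)=\begin{cases}0x & \text{if }\omega_1=i(s),\\ 0\,a(x)&\text{if }\omega_1\neq i(s),\end{cases}\qquad s\in\{b,c,d\}, \] with $i(b)=2$, $i(c)=1$, $i(d)=0$ and $\sigma$ the shift. The group $G_\omega$ acts on the infinite binary sequences, i.e. on the boundary of the tree; let $V$ be the orbit of $0^\infty$, which is the set of sequences with finitely many digits $1$, and let $\Gamma$ be the orbital graph on $V$ (without labels it does not depend on $\omega$). Let $\Gamma_+\subset V$ consist of $0^\infty$ and of the vertices that can be joined to $10^\infty$ by a path in $\Gamma$ avoiding $0^\infty$. Let $\mathcal{X}$ be the following cube complex. Its vertices are the subsets of $V$ whose symmetric difference with $\Gamma_+$ is finite; equivalently, they form the connected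 component of $\Gamma_+$ in the graph on the subsets of $V$ in which two subsets are joined by an edge when they differ by exactly one element. For every vertex $v$ and every finite set $F\subset V$ it has the cube, with edges of length one, spanned by the $2^{|F|}$ vertices that differ from $v$ only on $F$. Equip $\mathcal{X}$ with the path metric induced by the Euclidean metrics of its cubes and with the action of $G_\omega$ that extends the action $v\mapsto gv$ on vertices and is affine on cubes. Then $\mathcal{X}$ is a model for $\underline{E}G_\omega$, the classifying space of proper actions of the discrete group $G_\omega$. This means the following. An action of a discrete group $G$ by homeomorphisms on a space $Z$ is called proper if every point of $Z$ has a $G$-invariant open neighbourhood that admits a continuous $G$-equivariant map to $G/K$, with the discrete topology, for some finite subgroup $K$ of $G$. Then: 1. the action of $G_\omega$ on $\mathcal{X}$ is proper, and $\mathcal{X}$ and $G_\omega\backslash\mathcal{X}$ are metrizable; 2. for every space $Z$ with a proper action of $G_\omega$ and paracompact Hausdorff quotient $G_\omega\backslash Z$ (for example, $Z$ and $G_\omega\backslash Z$ metrizable), there is a continuous $G_\omega$-equivariant map $Z\to\mathcal{X}$; 3. for every such $Z$, any two continuous $G_\omega$-equivariant maps $Z\to\mathcal{X}$ are homotopic through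 $G_\omega$-equivariant maps. -/

import Mathlib

universe u v w

namespace GrigorchukCube

open scoped symmDiff

/-! ## The binary rooted tree, its boundary, and the Grigorchuk groups -/

/-- Automorphisms of the infinite binary rooted tree. The vertices of the tree are the finite binary
words (`false` is the letter `0`, `true` is the letter `1`), the level of a vertex is its length, and
`u` lies above `v` when `u` is a prefix of `v`. -/
def TreeAut : Subgroup (Equiv.Perm (List Bool)) where
  carrier := {g | (∀ u, (g u).length = u.length) ∧ ∀ u v, g u <+: g v ↔ u <+: v}
  one_mem' := by simp
  mul_mem' := by
    rintro g h ⟨hg, hg'⟩ ⟨hh, hh'⟩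
    refine ⟨fun u => ?_, fun u v => ?_⟩
    · rw [Equiv.Perm.mul_apply, hg, hh]
    · rw [Equiv.Perm.mul_apply, Equiv.Perm.mul_apply, hg', hh']
  inv_mem' := by
    rintro g ⟨hg, hg'⟩
    have h : ∀ u, g (g⁻¹ u) = u := fun u => g.apply_symm_apply u
    refine ⟨fun u => ?_, fun u v => ?_⟩
    · rw [← hg, h]
    · rw [← hg', h, h]

/-- The boundary of the tree: infinite binary sequences. -/
def Boundary : Type := ℕ → Bool

/-- The prefix of length `n` of an infinite sequence. -/
def pref (x : Boundary) (n : ℕ) : List Bool := (List.range n).map fun i => x i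

theorem length_pref (x : Boundary) (n : ℕ) : (pref x n).length = n := by
  simp [pref]

theorem pref_prefix (x : Boundary) {m n : ℕ} (h : m ≤ n) : pref x m <+: pref x n := by
  obtain ⟨k, rfl⟩ := Nat.exists_eq_add_of_le h
  unfold pref
  rw [List.range_add, List.map_append]
  exact List.prefix_append _ _

theorem getD_pref (x : Boundary) {n i : ℕ} (h : i < n) : (pref x n).getD i false = x i := by
  simp [pref, List.getD_eq_getElem?_getD, h]

theorem getD_of_prefix {u v : List Bool} (h : u <+: v) {i : ℕ} (hi : i < u.length) :
    u.getD i false = v.getD i false := by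
  obtain ⟨w, rfl⟩ := h
  simp [List.getD_eq_getElem?_getD, List.getElem?_append_left hi]

/-- Tree automorphisms act on the boundary: the prefix of length `n` of `g • x` is the image under
`g` of the prefix of length `n` of `x` (see `pref_smul`). -/
instance : SMul TreeAut Boundary :=
  ⟨fun g x n => (g.1 (pref x (n + 1))).getD n false⟩

theorem smul_apply (g : TreeAut) (x : Boundary) (n : ℕ) :
    (g • x) n = (g.1 (pref x (n + 1))).getD n false := rfl

theorem pref_smul (g : TreeAut) (x : Boundary) (n : ℕ) : pref (g • x) n = g.1 (pref x n) := by
  have hl : (g.1 (pref x n)).length = n := by rw [g.2.1, length_pref]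
  apply List.ext_getElem
  · rw [length_pref, hl]
  · intro i h1 h2
    rw [length_pref] at h1
    have e1 : (pref (g • x) n).getD i false = (g • x) i := getD_pref _ h1
    have e2 : (g.1 (pref x (i + 1))).getD i false = (g.1 (pref x n)).getD i false := by
      apply getD_of_prefix
      · exact (g.2.2 _ _).2 (pref_prefix x h1)
      · rw [g.2.1, length_pref]; omega
    rw [smul_apply, e2] at e1
    rw [List.getD_eq_getElem _ _ h2,
      List.getD_eq_getElem _ _ (by rw [length_pref]; exact h1)] at e1
    exact e1

instance : MulAction TreeAut Boundary where
  one_smul x := by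
    funext n
    rw [smul_apply]
    exact getD_pref x (Nat.lt_succ_self n)
  mul_smul g h x := by
    funext n
    rw [smul_apply, smul_apply, pref_smul]
    rfl

/-- The automorphism `a` on words: it flips the first letter. -/
def aFun : List Bool → List Bool
  | [] => []
  | b :: w => (!b) :: w

/-- The shift of a sequence. -/
def shift (ω : ℕ → Fin 3) : ℕ → Fin 3 := fun n => ω (n + 1)

/-- The automorphisms `b_ω` (for `i = 2`), `c_ω` (for `i = 1`) and `d_ω` (for `i = 0`) on words. -/
def genFun (i : Fin 3) : (ℕ → Fin 3) → List Bool → List Bool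
  | _, [] => []
  | ω, false :: w => if ω 0 = i then false :: w else false :: aFun w
  | ω, true :: w => true :: genFun i (shift ω) w

theorem aFun_aFun (w : List Bool) : aFun (aFun w) = w := by
  cases w <;> simp [aFun]

theorem length_aFun (w : List Bool) : (aFun w).length = w.length := by
  cases w <;> simp [aFun]

theorem aFun_prefix {u v : List Bool} (h : u <+: v) : aFun u <+: aFun v := by
  obtain ⟨w, rfl⟩ := h
  cases u with
  | nil => simp [aFun]
  | cons b u => simp [aFun]

theorem genFun_genFun (i : Fin 3) (ω : ℕ → Fin 3) (w : List Bool) :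
    genFun i ω (genFun i ω w) = w := by
  induction w generalizing ω with
  | nil => simp [genFun]
  | cons b w ih =>
    cases b with
    | false => by_cases h : ω 0 = i <;> simp [genFun, h, aFun_aFun]
    | true => simp [genFun, ih]

theorem length_genFun (i : Fin 3) (ω : ℕ → Fin 3) (w : List Bool) :
    (genFun i ω w).length = w.length := by
  induction w generalizing ω with
  | nil => simp [genFun]
  | cons b w ih =>
    cases b with
    | false => by_cases h : ω 0 = i <;> simp [genFun, h, length_aFun]
    | true => simp [genFun, ih]

theorem genFun_prefix (i : Fin 3) (ω : ℕ → Fin 3) {u v : List Bool} (h : u <+: v) :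
    genFun i ω u <+: genFun i ω v := by
  induction u generalizing ω v with
  | nil => simp [genFun]
  | cons b u ih =>
    obtain ⟨w, rfl⟩ := h
    have hu : u <+: u ++ w := List.prefix_append u w
    cases b with
    | false =>
      by_cases h : ω 0 = i
      · simp [genFun, h]
      · simpa [genFun, h] using aFun_prefix hu
    | true => simpa [genFun] using ih (shift ω) hu

/-- The automorphism `a` of the tree. -/
def aAut : TreeAut :=
  ⟨⟨aFun, aFun, aFun_aFun, aFun_aFun⟩, length_aFun, fun u v =>
    ⟨fun h => by simpa [aFun_aFun] using aFun_prefix h, aFun_prefix⟩⟩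

/-- The automorphisms `b_ω` (`i = 2`), `c_ω` (`i = 1`), `d_ω` (`i = 0`) of the tree. -/
def genAut (i : Fin 3) (ω : ℕ → Fin 3) : TreeAut :=
  ⟨⟨genFun i ω, genFun i ω, genFun_genFun i ω, genFun_genFun i ω⟩, length_genFun i ω, fun u v =>
    ⟨fun h => by simpa [genFun_genFun] using genFun_prefix i ω h, genFun_prefix i ω⟩⟩

/-- The generating set `{a, b_ω, c_ω, d_ω}`. -/
def gens (ω : ℕ → Fin 3) : Set TreeAut := {aAut, genAut 2 ω, genAut 1 ω, genAut 0 ω}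

/-- The Grigorchuk group `G_ω`. -/
def G (ω : ℕ → Fin 3) : Subgroup TreeAut := Subgroup.closure (gens ω)

theorem gens_mul_self {ω : ℕ → Fin 3} {s : TreeAut} (hs : s ∈ gens ω) : s * s = 1 := by
  simp only [gens, Set.mem_insert_iff, Set.mem_singleton_iff] at hs
  rcases hs with rfl | rfl | rfl | rfl
  · exact Subtype.ext (Equiv.ext aFun_aFun)
  all_goals exact Subtype.ext (Equiv.ext (genFun_genFun _ ω))

theorem gens_smul_smul {ω : ℕ → Fin 3} {s : TreeAut} (hs : s ∈ gens ω) (x : Boundary) :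
    s • s • x = x := by
  rw [smul_smul, gens_mul_self hs, one_smul]

/-- The sequence `x` with its letter at position `k` flipped. -/
def flip (k : ℕ) (x : Boundary) : Boundary := fun n => if n = k then !(x n) else x n

/-- The sequence `x` without its first letter. -/
def tail (x : Boundary) : Boundary := fun n => x (n + 1)

theorem pref_succ (x : Boundary) (n : ℕ) : pref x (n + 1) = x 0 :: pref (tail x) n := by
  unfold pref
  rw [List.range_succ_eq_map, List.map_cons, List.map_map]
  rfl

theorem aAut_smul (x : Boundary) : aAut • x = flip 0 x := by
  funext n
  have h : (aAut • x) n = (aFun (pref x (n + 1))).getD n false := rfl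
  rw [h, pref_succ]
  cases n with
  | zero => simp [aFun, flip]
  | succ n =>
    simp only [aFun, List.getD_cons_succ, flip, Nat.succ_ne_zero, if_false]
    exact getD_pref (tail x) (Nat.lt_succ_self n)

theorem genAut_smul_zero (i : Fin 3) (ω : ℕ → Fin 3) (x : Boundary) :
    (genAut i ω • x) 0 = x 0 := by
  have h : (genAut i ω • x) 0 = (genFun i ω (pref x 1)).getD 0 false := rfl
  rw [h, pref_succ]
  cases hx : x 0
  · by_cases h : ω 0 = i <;> simp [genFun, h]
  · simp [genFun]

theorem genAut_smul_of_true (i : Fin 3) (ω : ℕ → Fin 3) (x : Boundary) (hx : x 0 = true) :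
    tail (genAut i ω • x) = genAut i (shift ω) • tail x := by
  funext n
  have h : tail (genAut i ω • x) n = (genFun i ω (pref x (n + 2))).getD (n + 1) false := rfl
  rw [h, pref_succ, hx]
  rfl

theorem genAut_smul_of_false (i : Fin 3) (ω : ℕ → Fin 3) (x : Boundary) (hx : x 0 = false) :
    tail (genAut i ω • x) = if ω 0 = i then tail x else flip 0 (tail x) := by
  funext n
  have h : tail (genAut i ω • x) n = (genFun i ω (pref x (n + 2))).getD (n + 1) false := rfl
  rw [h, pref_succ, hx]
  by_cases h : ω 0 = i
  · simpa [genFun, h] using getD_pref (tail x) (Nat.lt_succ_self n)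
  · rw [if_neg h, ← aAut_smul]
    simp only [genFun, h, if_false, List.getD_cons_succ]
    rfl

theorem boundary_ext {x y : Boundary} (h0 : x 0 = y 0) (h : tail x = tail y) : x = y := by
  funext n
  cases n with
  | zero => exact h0
  | succ n => exact congrFun h n

theorem tail_flip (k : ℕ) (x : Boundary) : tail (flip (k + 1) x) = flip k (tail x) := by
  funext n
  simp [tail, flip]

/-- `k` is the position of the first letter `0` of `x`. -/
def FirstZero (x : Boundary) (k : ℕ) : Prop := (∀ j < k, x j = true) ∧ x k = false

theorem genAut_smul (i : Fin 3) (ω : ℕ → Fin 3) {x : Boundary} {k : ℕ} (h : FirstZero x k) :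
    genAut i ω • x = if ω k = i then x else flip (k + 1) x := by
  induction k generalizing ω x with
  | zero =>
    apply boundary_ext
    · rw [genAut_smul_zero]; split_ifs <;> simp [flip]
    · rw [genAut_smul_of_false i ω x h.2]
      split_ifs
      · rfl
      · rw [tail_flip]
  | succ k ih =>
    have h' : FirstZero (tail x) k := ⟨fun j hj => h.1 (j + 1) (by omega), h.2⟩
    apply boundary_ext
    · rw [genAut_smul_zero]; split_ifs <;> simp [flip]
    · rw [genAut_smul_of_true i ω x (h.1 0 (by omega)), ih (shift ω) h']
      have : shift ω k = ω (k + 1) := rfl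
      rw [this]
      split_ifs
      · rfl
      · rw [tail_flip]

theorem exists_firstZero {x : Boundary} (h : {n | x n = true}.Finite) : ∃ k, FirstZero x k := by
  classical
  have h2 : ∃ k, x k = false := by
    by_contra hc
    push Not at hc
    have : {n | x n = true} = Set.univ := by
      ext n; simpa using hc n
    rw [this] at h
    exact Set.infinite_univ h
  refine ⟨Nat.find h2, fun j hj => ?_, Nat.find_spec h2⟩
  simpa using Nat.find_min h2 hj

theorem flip_finite (k : ℕ) {x : Boundary} (h : {n | x n = true}.Finite) :
    {n | flip k x n = true}.Finite := by
  apply (h.union (Set.finite_singleton k)).subset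
  intro n hn
  by_cases hk : n = k
  · right; exact hk
  · left; simpa [flip, hk] using hn

theorem flip_flip (k : ℕ) (x : Boundary) : flip k (flip k x) = x := by
  funext n
  by_cases h : n = k <;> simp [flip, h]

theorem flip_ne (k : ℕ) (x : Boundary) : flip k x ≠ x := by
  intro h
  have := congrFun h k
  simp [flip] at this

theorem gens_finite {ω : ℕ → Fin 3} {s : TreeAut} (hs : s ∈ gens ω) {x : Boundary}
    (h : {n | x n = true}.Finite) : {n | (s • x) n = true}.Finite := by
  obtain ⟨k, hk⟩ := exists_firstZero h
  simp only [gens, Set.mem_insert_iff, Set.mem_singleton_iff] at hs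
  rcases hs with rfl | rfl | rfl | rfl
  · rw [aAut_smul]; exact flip_finite 0 h
  all_goals
    rw [genAut_smul _ ω hk]
    split_ifs
    · exact h
    · exact flip_finite _ h

theorem smul_finite {ω : ℕ → Fin 3} {g : TreeAut} (hg : g ∈ G ω) :
    ∀ {x : Boundary}, {n | x n = true}.Finite → {n | (g • x) n = true}.Finite := by
  refine Subgroup.closure_induction'' (p := fun g _ => ∀ {x : Boundary},
    {n | x n = true}.Finite → {n | (g • x) n = true}.Finite) ?_ ?_ ?_ ?_ hg
  · intro s hs x hx
    exact gens_finite hs hx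
  · intro s hs x hx
    rw [inv_eq_of_mul_eq_one_left (gens_mul_self hs)]
    exact gens_finite hs hx
  · intro x hx
    rwa [one_smul]
  · intro g h _ _ ihg ihh x hx
    rw [mul_smul]
    exact ihg (ihh hx)

/-! ## The graph `Γ` and the half-line `Γ₊` -/

/-- The vertices of `Γ`: the infinite binary sequences with finitely many `1`. This is the orbit of
`0^∞` under `G_ω`, for every `ω` (see `orbit_zeroSeq`). -/
def V : Type := {x : Boundary // {n | x n = true}.Finite}

instance (ω : ℕ → Fin 3) : MulAction (G ω) V where
  smul g x := ⟨g.1 • x.1, smul_finite g.2 x.2⟩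
  one_smul x := Subtype.ext (one_smul TreeAut x.1)
  mul_smul g h x := Subtype.ext (mul_smul g.1 h.1 x.1)

/-- The sequence `0^∞`. -/
def zeroSeq : V := ⟨fun _ => false, by simp⟩

/-- Flipping one letter of a vertex of `Γ`. -/
def V.flip (k : ℕ) (x : V) : V := ⟨GrigorchukCube.flip k x.1, flip_finite k x.2⟩

/-- The sequence `10^∞`. -/
def oneSeq : V := V.flip 0 zeroSeq

/-- The orbital graph of `G_ω` acting on the orbit of `0^∞`, without labels, loops and multiple
edges. -/
def orbitalGraph (ω : ℕ → Fin 3) : SimpleGraph V where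
  Adj x y := x ≠ y ∧ ∃ s ∈ gens ω, s • x.1 = y.1
  symm := ⟨by
    rintro x y ⟨h, s, hs, e⟩
    exact ⟨h.symm, s, hs, by rw [← e, gens_smul_smul hs]⟩⟩
  loopless := ⟨fun _ h => h.1 rfl⟩

/-- The graph `Γ`: two vertices are joined by an edge if they differ exactly in the first letter, or
exactly in the letter that follows the first `0`. This is the common orbital graph of all the groups
`G_ω` (see `orbitalGraph_eq`). -/
def Γ : SimpleGraph V where
  Adj x y := y = V.flip 0 x ∨ ∃ k, FirstZero x.1 k ∧ y = V.flip (k + 1) x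
  symm := ⟨by
    rintro x y (rfl | ⟨k, hk, rfl⟩)
    · left; exact (Subtype.ext (flip_flip 0 x.1)).symm
    · right
      refine ⟨k, ⟨fun j hj => ?_, ?_⟩, (Subtype.ext (flip_flip (k + 1) x.1)).symm⟩
      · have : j ≠ k + 1 := by omega
        simpa [V.flip, GrigorchukCube.flip, this] using hk.1 j hj
      · simpa [V.flip, GrigorchukCube.flip] using hk.2⟩
  loopless := ⟨by
    rintro x (h | ⟨k, -, h⟩)
    · exact flip_ne _ _ (congrArg Subtype.val h).symm
    · exact flip_ne _ _ (congrArg Subtype.val h).symm⟩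

theorem exists_gen_ne (j : Fin 3) : ∃ i : Fin 3, j ≠ i := ⟨j + 1, by revert j; decide⟩

theorem genAut_mem (i : Fin 3) (ω : ℕ → Fin 3) : genAut i ω ∈ gens ω := by
  fin_cases i <;> simp [gens]

/-- For every `ω`, the orbital graph of `G_ω` is `Γ`. -/
theorem orbitalGraph_eq (ω : ℕ → Fin 3) : orbitalGraph ω = Γ := by
  ext x y
  constructor
  · rintro ⟨hne, s, hs, e⟩
    obtain ⟨k, hk⟩ := exists_firstZero x.2
    simp only [gens, Set.mem_insert_iff, Set.mem_singleton_iff] at hs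
    rcases hs with rfl | rfl | rfl | rfl
    · left; exact Subtype.ext (by rw [← e, aAut_smul]; rfl)
    all_goals
      right
      rw [genAut_smul _ ω hk] at e
      split_ifs at e
      · exact absurd (Subtype.ext e) hne
      · exact ⟨k, hk, Subtype.ext e.symm⟩
  · intro h
    refine ⟨h.ne, ?_⟩
    rcases h with rfl | ⟨k, hk, rfl⟩
    · exact ⟨aAut, by simp [gens], aAut_smul _⟩
    · obtain ⟨i, hi⟩ := exists_gen_ne (ω k)
      refine ⟨genAut i ω, genAut_mem i ω, ?_⟩
      rw [genAut_smul _ ω hk, if_neg hi]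
      rfl

theorem smul_adj_or_eq {ω : ℕ → Fin 3} {s : G ω} (hs : s.1 ∈ gens ω) (x : V) :
    s • x = x ∨ Γ.Adj x (s • x) := by
  by_cases h : s • x = x
  · exact Or.inl h
  · right
    rw [← orbitalGraph_eq ω]
    exact ⟨fun e => h e.symm, s.1, hs, rfl⟩

theorem reachable_of_agree (n : ℕ) : ∀ x y : V, (∀ m, n ≤ m → x.1 m = y.1 m) →
    Γ.Reachable x y := by
  induction n with
  | zero =>
    intro x y h
    have : x = y := Subtype.ext (funext fun m => h m (Nat.zero_le m))
    rw [this]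
  | succ n ih =>
    intro x y h
    by_cases hn : x.1 n = y.1 n
    · apply ih
      intro m hm
      rcases Nat.eq_or_lt_of_le hm with rfl | hm
      · exact hn
      · exact h m hm
    · rcases Nat.eq_zero_or_pos n with rfl | hpos
      · have : y = V.flip 0 x := by
          apply Subtype.ext
          funext m
          by_cases hm : m = 0
          · subst hm
            show y.1 0 = GrigorchukCube.flip 0 x.1 0
            simp only [GrigorchukCube.flip, if_true]
            revert hn
            cases x.1 0 <;> cases y.1 0 <;> simp
          · show y.1 m = GrigorchukCube.flip 0 x.1 m
            simp only [GrigorchukCube.flip, hm, if_false]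
            exact (h m (by omega)).symm
        exact SimpleGraph.Adj.reachable (Or.inl this)
      · obtain ⟨k, rfl⟩ : ∃ k, n = k + 1 := ⟨n - 1, by omega⟩
        have hfin : {m | (fun m => if m < k then true else if m = k then false else x.1 m :
            Boundary) m = true}.Finite := by
          apply ((Set.finite_lt_nat k).union x.2).subset
          intro m hm
          by_cases h1 : m < k
          · exact Or.inl h1
          · right
            by_cases h2 : m = k
            · simp [h2] at hm
            · simpa [h1, h2] using hm
        let z : V := ⟨fun m => if m < k then true else if m = k then false else x.1 m, hfin⟩
        have hz : FirstZero z.1 k := by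
          refine ⟨fun j hj => ?_, ?_⟩
          · show (if j < k then true else if j = k then false else x.1 j) = true
            simp [hj]
          · show (if k < k then true else if k = k then false else x.1 k) = false
            simp
        have h1 : Γ.Reachable x z := by
          apply ih
          intro m hm
          show x.1 m = if m < k then true else if m = k then false else x.1 m
          have a1 : ¬ m < k := by omega
          have a2 : ¬ m = k := by omega
          simp [a1, a2]
        have h2 : Γ.Reachable z (V.flip (k + 1) z) :=
          SimpleGraph.Adj.reachable (Or.inr ⟨k, hz, rfl⟩)
        have h3 : Γ.Reachable (V.flip (k + 1) z) y := by
          apply ih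
          intro m hm
          show (if m = k + 1 then !(if m < k then true else if m = k then false else x.1 m)
            else if m < k then true else if m = k then false else x.1 m) = y.1 m
          have a1 : ¬ m < k := by omega
          have a2 : ¬ m = k := by omega
          by_cases hmk : m = k + 1
          · subst hmk
            simp only [a1, a2, if_true, if_false]
            revert hn
            cases x.1 (k + 1) <;> cases y.1 (k + 1) <;> simp
          · simp only [a1, a2, hmk, if_false]
            exact h m (by omega)
        exact (h1.trans h2).trans h3

/-- The orbit of `0^∞` under `G_ω` consists of all the sequences with finitely many `1`. -/
theorem orbit_zeroSeq (ω : ℕ → Fin 3) : MulAction.orbit (G ω) zeroSeq = Set.univ := by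
  apply Set.eq_univ_of_forall
  intro x
  have hx : Γ.Reachable zeroSeq x := by
    obtain ⟨n, hn⟩ := x.2.bddAbove
    apply reachable_of_agree (n + 1)
    intro m hm
    show false = x.1 m
    by_contra hc
    have : x.1 m = true := by simpa using (Ne.symm hc)
    have := hn this
    omega
  obtain ⟨p⟩ := hx
  have : ∀ {u v : V}, Γ.Walk u v → u ∈ MulAction.orbit (G ω) zeroSeq →
      v ∈ MulAction.orbit (G ω) zeroSeq := by
    intro u v p
    induction p with
    | nil => exact id
    | cons h _ ih =>
      intro hu
      apply ih
      rw [← orbitalGraph_eq ω] at h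
      obtain ⟨-, s, hs, e⟩ := h
      obtain ⟨g, rfl⟩ := hu
      exact ⟨⟨s, Subgroup.subset_closure hs⟩ * g, by
        show (_ * g) • zeroSeq = _
        rw [mul_smul]
        exact Subtype.ext e⟩
  exact this p (MulAction.mem_orbit_self _)

/-- The set `Γ₊`: the vertex `0^∞` and all the vertices on its right side, the side of `10^∞`, that
is, the vertices joined to `10^∞` by a path that avoids `0^∞`. -/
def ΓPlus : Set V := {x | x = zeroSeq ∨ ∃ p : Γ.Walk oneSeq x, zeroSeq ∉ p.support}

/-! ## The cube complex `X` -/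

/-- The graph of 2-colorings of the vertices of `Γ`. A coloring is given by its support, the set of
vertices of `Γ` that have color `1`; two colorings are joined by an edge if they differ on exactly
one vertex of `Γ`. -/
def coloringGraph : SimpleGraph (Set V) where
  Adj v w := ∃ x, v ∆ w = {x}
  symm := ⟨by
    rintro v w ⟨x, h⟩
    exact ⟨x, by rw [symmDiff_comm, h]⟩⟩
  loopless := ⟨by
    rintro v ⟨x, h⟩
    rw [symmDiff_self] at h
    exact Set.singleton_ne_empty x h.symm⟩

/-- The vertices of `X`: the colorings in the connected component of the coloring with support
`Γ₊`. -/
def IsVertex (v : Set V) : Prop := coloringGraph.Reachable ΓPlus v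

/-- The cube `C(v, x₁, …, xₙ)`, where `F = {x₁, …, xₙ}`, spanned by the `2 ^ n` colorings that
differ from `v` only on `F`. A point of the cube has a coordinate in `[0, 1]` for every element of
`F`; these are recorded as a function on all of `V(Γ)` whose values off `F` are the colors of `v`.
Thus the vertices of the cube are its `{0, 1}`-valued functions, and two cubes are glued exactly
along their common face. -/
def cube (v : Set V) (F : Finset V) : Set (V → ℝ) :=
  {φ | (∀ x, φ x ∈ Set.Icc (0 : ℝ) 1) ∧ ∀ x ∉ F, φ x = v.indicator 1 x}

/-- The cube complex `X`: the union of the cubes spanned by its vertices. -/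
def X : Type := {φ : V → ℝ // ∃ (v : Set V) (F : Finset V), IsVertex v ∧ φ ∈ cube v F}

theorem finite_of_reachable {v w : Set V} (h : coloringGraph.Reachable v w) : (v ∆ w).Finite := by
  obtain ⟨p⟩ := h
  induction p with
  | nil => simp
  | cons h _ ih =>
    obtain ⟨x, hx⟩ := h
    exact ((hx ▸ Set.finite_singleton x).union ih).subset (symmDiff_triangle _ _ _)

theorem reachable_of_finite {v w : Set V} (h : (v ∆ w).Finite) : coloringGraph.Reachable v w := by
  have key : ∀ S : Set V, S.Finite → ∀ v : Set V, coloringGraph.Reachable v (v ∆ S) := by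
    intro S hS
    induction S, hS using Set.Finite.induction_on with
    | empty => intro v; rw [← Set.bot_eq_empty, symmDiff_bot]
    | @insert x S hx _ ih =>
      intro v
      refine (ih v).trans (SimpleGraph.Adj.reachable ⟨x, ?_⟩)
      ext y
      simp only [Set.mem_symmDiff, Set.mem_insert_iff, Set.mem_singleton_iff]
      by_cases hy : y = x
      · subst hy; tauto
      · tauto
  have := key _ h v
  rwa [symmDiff_symmDiff_cancel_left] at this

/-- The points of `X` are the functions with values in `[0, 1]` that differ from the indicator
function of `Γ₊` at finitely many places. -/
theorem mem_X_iff (φ : V → ℝ) : (∃ (v : Set V) (F : Finset V), IsVertex v ∧ φ ∈ cube v F) ↔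
    (∀ x, φ x ∈ Set.Icc (0 : ℝ) 1) ∧ {x | φ x ≠ ΓPlus.indicator 1 x}.Finite := by
  constructor
  · rintro ⟨v, F, hv, h1, h2⟩
    refine ⟨h1, ((finite_of_reachable hv).union F.finite_toSet).subset ?_⟩
    intro x hx
    by_contra hc
    simp only [Set.mem_union, not_or, Set.mem_symmDiff, SetLike.mem_coe] at hc
    apply hx
    rw [h2 x hc.2]
    by_cases hxv : x ∈ v
    · have : x ∈ ΓPlus := by_contra fun h => hc.1.2 ⟨hxv, h⟩
      simp [hxv, this]
    · have : x ∉ ΓPlus := fun h => hc.1.1 ⟨h, hxv⟩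
      simp [hxv, this]
  · rintro ⟨h1, h2⟩
    refine ⟨ΓPlus, h2.toFinset, SimpleGraph.Reachable.refl _, h1, ?_⟩
    intro x hx
    by_contra hc
    exact hx (h2.mem_toFinset.2 hc)

/-- Two points of `X` lie in a common cube of `X`. -/
def InCommonCube (φ ψ : X) : Prop :=
  ∃ (v : Set V) (F : Finset V), IsVertex v ∧ φ.1 ∈ cube v F ∧ ψ.1 ∈ cube v F

/-- The Euclidean distance of two points of a common cube: there, all but finitely many terms of
the sum are zero. -/
noncomputable def euclid (φ ψ : V → ℝ) : ℝ := Real.sqrt (∑ᶠ x, (φ x - ψ x) ^ 2)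

/-- The lengths of the strings from `φ` to `ψ`: a string is a finite sequence of points of `X` in
which consecutive points lie in a common cube, and its length is the sum of the Euclidean distances
of consecutive points. -/
def stringLengths (φ ψ : X) : Set ℝ :=
  {L | ∃ (m : ℕ) (p : ℕ → X), p 0 = φ ∧ p m = ψ ∧ (∀ i < m, InCommonCube (p i) (p (i + 1))) ∧
    L = ∑ i ∈ Finset.range m, euclid (p i).1 (p (i + 1)).1}

theorem finite_ne (φ ψ : X) : {x | φ.1 x ≠ ψ.1 x}.Finite := by
  apply (((mem_X_iff _).1 φ.2).2.union ((mem_X_iff _).1 ψ.2).2).subset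
  intro x hx
  by_contra hc
  simp only [Set.mem_union, Set.mem_ofPred_eq, not_or, not_not] at hc
  exact hx (hc.1.trans hc.2.symm)

theorem inCommonCube (φ ψ : X) : InCommonCube φ ψ := by
  classical
  have h1 := (mem_X_iff _).1 φ.2
  have h2 := (mem_X_iff _).1 ψ.2
  refine ⟨ΓPlus, h1.2.toFinset ∪ h2.2.toFinset, SimpleGraph.Reachable.refl _,
    ⟨h1.1, fun x hx => ?_⟩, ⟨h2.1, fun x hx => ?_⟩⟩
  · by_contra hc
    exact hx (Finset.mem_union_left _ (h1.2.mem_toFinset.2 hc))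
  · by_contra hc
    exact hx (Finset.mem_union_right _ (h2.2.mem_toFinset.2 hc))

theorem euclid_eq (φ ψ : X) (F : Finset V) (hF : ∀ x, φ.1 x ≠ ψ.1 x → x ∈ F) :
    euclid φ.1 ψ.1 = dist (WithLp.toLp 2 fun x : F => φ.1 x : EuclideanSpace ℝ F)
      (WithLp.toLp 2 fun x : F => ψ.1 x) := by
  rw [EuclideanSpace.dist_eq, euclid]
  congr 1
  rw [finsum_eq_sum_of_support_subset (s := F)]
  · rw [← Finset.sum_coe_sort]
    apply Finset.sum_congr rfl
    intro x _
    rw [Real.dist_eq, sq_abs]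
  · intro x hx
    apply hF
    intro h
    apply hx
    simp [h]

theorem euclid_triangle (φ ψ χ : X) : euclid φ.1 χ.1 ≤ euclid φ.1 ψ.1 + euclid ψ.1 χ.1 := by
  classical
  let F : Finset V := (finite_ne φ χ).toFinset ∪ ((finite_ne φ ψ).toFinset ∪
    (finite_ne ψ χ).toFinset)
  rw [euclid_eq φ χ F, euclid_eq φ ψ F, euclid_eq ψ χ F]
  · exact dist_triangle _ _ _
  all_goals
    intro x hx
    simp [F, hx]

theorem euclid_self (φ : X) : euclid φ.1 φ.1 = 0 := by
  simp [euclid]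

theorem euclid_le_sum (p : ℕ → X) (m : ℕ) :
    euclid (p 0).1 (p m).1 ≤ ∑ i ∈ Finset.range m, euclid (p i).1 (p (i + 1)).1 := by
  induction m with
  | zero => simp [euclid_self]
  | succ m ih =>
    rw [Finset.sum_range_succ]
    exact (euclid_triangle _ (p m) _).trans (by linarith)

theorem isLeast_euclid (φ ψ : X) : IsLeast (stringLengths φ ψ) (euclid φ.1 ψ.1) := by
  constructor
  · refine ⟨1, fun i => if i = 0 then φ else ψ, rfl, rfl, ?_, ?_⟩
    · intro i _
      exact inCommonCube _ _
    · simp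
  · rintro L ⟨m, p, rfl, rfl, -, rfl⟩
    exact euclid_le_sum p m

/-- The metric of the cube complex: the distance of two points is the infimum of the lengths of the
strings between them. The topology of `X` is the one of this metric. -/
noncomputable instance : MetricSpace X where
  dist φ ψ := sInf (stringLengths φ ψ)
  dist_self φ := by rw [(isLeast_euclid φ φ).csInf_eq, euclid_self]
  dist_comm φ ψ := by
    rw [(isLeast_euclid φ ψ).csInf_eq, (isLeast_euclid ψ φ).csInf_eq, euclid, euclid]
    congr 2
    funext x
    ring
  dist_triangle φ ψ χ := by
    rw [(isLeast_euclid φ ψ).csInf_eq, (isLeast_euclid ψ χ).csInf_eq,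
      (isLeast_euclid φ χ).csInf_eq]
    exact euclid_triangle φ ψ χ
  eq_of_dist_eq_zero {φ ψ} h := by
    rw [(isLeast_euclid φ ψ).csInf_eq,
      euclid_eq φ ψ (finite_ne φ ψ).toFinset (fun x hx => by simpa using hx), dist_eq_zero] at h
    apply Subtype.ext
    funext x
    by_contra hc
    have h' := congrArg (fun f : EuclideanSpace ℝ (finite_ne φ ψ).toFinset =>
      f ⟨x, by simpa using hc⟩) h
    exact hc h'

theorem dist_eq_euclid (φ ψ : X) : dist φ ψ = euclid φ.1 ψ.1 := (isLeast_euclid φ ψ).csInf_eq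

/-! ## The action of `G_ω` on `X` -/

theorem gens_leave {ω : ℕ → Fin 3} {s : G ω} (hs : s.1 ∈ gens ω) {x : V} (hx : x ∈ ΓPlus)
    (h0 : x ≠ zeroSeq) : s • x ∈ ΓPlus := by
  rcases smul_adj_or_eq hs x with h | h
  · rwa [h]
  · by_cases h1 : s • x = zeroSeq
    · exact Or.inl h1
    · right
      rcases hx with hx | ⟨p, hp⟩
      · exact absurd hx h0
      · refine ⟨p.concat h, ?_⟩
        rw [SimpleGraph.Walk.support_concat]
        simp only [List.mem_append, List.mem_singleton, not_or]
        exact ⟨hp, fun e => h1 e.symm⟩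

theorem gens_commensurate {ω : ℕ → Fin 3} {s : G ω} (hs : s.1 ∈ gens ω) :
    {x | ¬ (s • x ∈ ΓPlus ↔ x ∈ ΓPlus)}.Finite := by
  have hss : ∀ x : V, s • s • x = x := fun x => Subtype.ext (gens_smul_smul hs x.1)
  apply ((Set.finite_singleton zeroSeq).union (Set.finite_singleton (s • zeroSeq))).subset
  intro x hx
  by_contra hc
  simp only [Set.mem_union, Set.mem_singleton_iff, not_or] at hc
  apply hx
  constructor
  · intro h
    have := gens_leave hs h (fun e => hc.2 (by rw [← e, hss]))
    rwa [hss] at this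
  · intro h
    exact gens_leave hs h hc.1

/-- The set `Γ₊` is commensurated by `G_ω`. -/
theorem commensurate {ω : ℕ → Fin 3} (g : G ω) :
    {x | ¬ (g • x ∈ ΓPlus ↔ x ∈ ΓPlus)}.Finite := by
  obtain ⟨g, hg⟩ := g
  refine Subgroup.closure_induction'' (p := fun g hg =>
    {x : V | ¬ ((⟨g, hg⟩ : G ω) • x ∈ ΓPlus ↔ x ∈ ΓPlus)}.Finite) ?_ ?_ ?_ ?_ hg
  · intro s hs
    exact gens_commensurate (s := ⟨s, Subgroup.subset_closure hs⟩) hs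
  · intro s hs
    have h1 : s⁻¹ = s := inv_eq_of_mul_eq_one_left (gens_mul_self hs)
    have h2 : s⁻¹ ∈ gens ω := by rwa [h1]
    exact gens_commensurate (s := ⟨s⁻¹, Subgroup.subset_closure h2⟩) h2
  · apply Set.finite_empty.subset
    intro x hx
    apply hx
    have : (⟨1, Subgroup.one_mem _⟩ : G ω) • x = x := one_smul (G ω) x
    rw [this]
  · intro g h hg hh ihg ihh
    have e : ∀ x : V, (⟨g * h, Subgroup.mul_mem _ hg hh⟩ : G ω) • x =
        (⟨g, hg⟩ : G ω) • (⟨h, hh⟩ : G ω) • x := fun x => mul_smul (⟨g, hg⟩ : G ω) ⟨h, hh⟩ x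
    apply (ihh.union (ihg.preimage (f := fun x : V => (⟨h, hh⟩ : G ω) • x)
      (MulAction.injective _).injOn)).subset
    intro x hx
    by_contra hc
    simp only [Set.mem_union, Set.mem_ofPred_eq, Set.mem_preimage, not_or, not_not] at hc
    apply hx
    rw [e]
    exact hc.2.trans hc.1

/-- The action of `G_ω` on `X`: `(g φ)(x) = φ (g⁻¹ x)`. On the vertices of `X` this is the action of
`G_ω` on colorings, and it maps cubes to cubes. -/
instance (ω : ℕ → Fin 3) : MulAction (G ω) X where
  smul g φ := ⟨fun x => φ.1 (g⁻¹ • x), by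
    have h := (mem_X_iff _).1 φ.2
    rw [mem_X_iff]
    refine ⟨fun x => h.1 _, ?_⟩
    apply ((h.2.preimage (f := fun x : V => g⁻¹ • x) (MulAction.injective _).injOn).union
      (commensurate g⁻¹)).subset
    intro x hx
    by_contra hc
    simp only [Set.mem_union, Set.mem_ofPred_eq, Set.mem_preimage, not_or, not_not] at hc
    apply hx
    show φ.1 (g⁻¹ • x) = _
    rw [hc.1]
    by_cases hxv : x ∈ ΓPlus
    · simp [hxv, hc.2.2 hxv]
    · have : g⁻¹ • x ∉ ΓPlus := fun h' => hxv (hc.2.1 h')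
      simp [hxv, this]⟩
  one_smul φ := Subtype.ext (funext fun x => by
    show φ.1 ((1 : G ω)⁻¹ • x) = φ.1 x
    rw [inv_one, one_smul])
  mul_smul g h φ := Subtype.ext (funext fun x => by
    show φ.1 ((g * h)⁻¹ • x) = φ.1 (h⁻¹ • g⁻¹ • x)
    rw [mul_inv_rev, mul_smul])

/-! ## Proper actions and their classifying spaces -/

/-- A proper action of a discrete group `H` on a topological space `Z`: the group acts by
homeomorphisms, and every point has an open `H`-invariant neighbourhood `U` with a continuous
`H`-equivariant map to the discrete space `H ⧸ K` for some finite subgroup `K`. -/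
structure IsProperAction (H : Type*) [Group H] (Z : Type*) [TopologicalSpace Z]
    [MulAction H Z] : Prop where
  continuous_smul : ∀ h : H, Continuous fun z : Z => h • z
  slice : ∀ z : Z, ∃ U : Set Z, IsOpen U ∧ z ∈ U ∧ (∀ (h : H), ∀ u ∈ U, h • u ∈ U) ∧
    ∃ K : Subgroup H, (K : Set H).Finite ∧ ∃ ρ : U → H ⧸ K, IsLocallyConstant ρ ∧
      ∀ (h : H) (u : U) (hu : h • u.1 ∈ U), ρ ⟨h • u.1, hu⟩ = h • ρ u

/-- `E` is a model for the classifying space of proper actions of the discrete group `H`. It is a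
proper `H`-space in the sense of Baum, Connes and Higson (the action is proper, and `E` and `H\E`
are metrizable), and it is universal: every space `Z` with a proper `H`-action has an `H`-equivariant
continuous map to `E`, and any two such maps are homotopic through `H`-equivariant maps. The
universality is asked for all `Z` whose quotient `H\Z` is paracompact Hausdorff, in particular for
all `Z` such that `Z` and `H\Z` are metrizable. -/
structure IsModelEUnderline (H : Type v) [Group H] (E : Type w) [TopologicalSpace E]
    [MulAction H E] : Prop where
  proper : IsProperAction H E
  metrizable : TopologicalSpace.MetrizableSpace E
  metrizable_quotient : TopologicalSpace.MetrizableSpace (Quotient (MulAction.orbitRel H E))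
  exists_map : ∀ (Z : Type u) [TopologicalSpace Z] [MulAction H Z], IsProperAction H Z →
    T2Space (Quotient (MulAction.orbitRel H Z)) →
    ParacompactSpace (Quotient (MulAction.orbitRel H Z)) →
    ∃ f : C(Z, E), ∀ (h : H) (z : Z), f (h • z) = h • f z
  homotopic : ∀ (Z : Type u) [TopologicalSpace Z] [MulAction H Z], IsProperAction H Z →
    T2Space (Quotient (MulAction.orbitRel H Z)) →
    ParacompactSpace (Quotient (MulAction.orbitRel H Z)) →
    ∀ f₀ f₁ : C(Z, E), (∀ (h : H) (z : Z), f₀ (h • z) = h • f₀ z) →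
      (∀ (h : H) (z : Z), f₁ (h • z) = h • f₁ z) →
      ∃ F : f₀.Homotopy f₁, ∀ (t : unitInterval) (h : H) (z : Z), F (t, h • z) = h • F (t, z)

end GrigorchukCube

/-!
Sending a point of `X` to its coordinates minus those of `Γ₊` embeds `X` isometrically into `ℓ²`, in
such a way that the image and the graphs of the group elements are convex. Equivariant maps into `X`
can therefore be averaged over a finite stabilizer, glued along an invariant partition of unity, and
joined by straight line homotopies. Orbits in `X` are discrete, because the points of an orbit share
their finitely many coordinates, so properness and metrizability of the quotient reduce to the
finiteness of the stabilizers.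

Passing to sections far down the tree, the finiteness is reduced to the stabilizers of `Γ₊` and of
`Γ₊ ∖ {0^∞}`. An element that stabilizes `Γ₊ ∖ {0^∞}` fixes the first level: otherwise its section
at `0` would carry one more point into `Γ₊` than out of it, whereas a group generated by involutions
has no nontrivial homomorphism to `ℤ`. Its sections stabilize `Γ₊` and `Γ₊ ∖ {0^∞}` and are shorter
words. By induction it lies in the Klein four-group `{1, b, c, d}`, and the stabilizer of `Γ₊` in
the dihedral group of order eight that is generated by `a` and by the one of `b, c, d` that fixes
`0^∞`. The sections alone would allow more elements; the surplus is excluded by a homomorphism to a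
dihedral group, whose values at the two sections of an element of `G_ω` correspond to each other
under an automorphism that exchanges the two classes of reflections.
-/

namespace GrigorchukCube

/-! ### Isometric actions -/

section IsometricAction

open Metric MulAction TopologicalSpace

variable {H E : Type*} [Group H] [MetricSpace E] [MulAction H E]

variable (H E) in
/-- The orbits of an action on a metric space are separated if every point has a positive distance
from the other points of each orbit, its own included. Equivalently, all orbits are closed and
discrete. -/
def HasSeparatedOrbits : Prop :=
  ∀ x y : E, ∃ ε > 0, ∀ h : H, dist x (h • y) < ε → x = h • y

theorem HasSeparatedOrbits.isClosed_orbit (hsep : HasSeparatedOrbits H E) (x : E) :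
    IsClosed (orbit H x) := by
  refine isClosed_of_closure_subset fun y hy => ?_
  obtain ⟨ε, hε, hεx⟩ := hsep y x
  obtain ⟨_, ⟨h, rfl⟩, hh⟩ := mem_closure_iff.1 hy ε hε
  exact ⟨h, (hεx h hh).symm⟩

variable (H E) in
/-- The closure of an orbit, as a map from the orbit space to the closed subsets, which carry the
Hausdorff distance. -/
def orbitClosure : Quotient (orbitRel H E) → Closeds E :=
  Quotient.lift (fun x => Closeds.closure (orbit H x)) fun _ _ h =>
    congrArg Closeds.closure (orbit_eq_iff.2 h)

theorem edist_orbitClosure_mk (x y : E) :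
    edist (orbitClosure H E ⟦x⟧) (orbitClosure H E ⟦y⟧) =
      hausdorffEDist (orbit H x) (orbit H y) :=
  hausdorffEDist_closure

theorem HasSeparatedOrbits.injective_orbitClosure (hsep : HasSeparatedOrbits H E) :
    Function.Injective (orbitClosure H E) := by
  rintro ⟨x⟩ ⟨y⟩ hxy
  have horbit : closure (orbit H x) = closure (orbit H y) := congrArg SetLike.coe hxy
  rw [(hsep.isClosed_orbit x).closure_eq, (hsep.isClosed_orbit y).closure_eq] at horbit
  exact Quotient.sound (orbit_eq_iff.1 horbit)

variable [IsIsometricSMul H E]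

theorem exists_mem_orbit_edist_le {x y z : E} (hz : z ∈ orbit H x) :
    ∃ w ∈ orbit H y, edist z w ≤ edist x y := by
  obtain ⟨h, rfl⟩ := hz
  exact ⟨h • y, mem_orbit y h, (edist_smul_left h x y).le⟩

theorem hausdorffEDist_orbit_le (x y : E) :
    hausdorffEDist (orbit H x) (orbit H y) ≤ edist x y :=
  hausdorffEDist_le_of_mem_edist (fun _ => exists_mem_orbit_edist_le)
    fun _ hz => edist_comm x y ▸ exists_mem_orbit_edist_le hz

theorem preimage_orbitClosure_eball (x : E) (ε : ENNReal) :
    orbitClosure H E ⁻¹' eball (orbitClosure H E ⟦x⟧) ε =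
      Quotient.mk (orbitRel H E) '' eball x ε := by
  ext q
  constructor
  · induction q using Quotient.inductionOn with | h y
    intro hy
    rw [Set.mem_preimage, mem_eball', edist_orbitClosure_mk] at hy
    obtain ⟨z, hz, hxz⟩ := exists_edist_lt_of_hausdorffEDist_lt (mem_orbit_self x) hy
    exact ⟨z, mem_eball'.2 hxz, Quotient.sound hz⟩
  · rintro ⟨y, hy, rfl⟩
    rw [Set.mem_preimage, mem_eball, edist_orbitClosure_mk]
    exact (hausdorffEDist_orbit_le y x).trans_lt hy

theorem isInducing_orbitClosure : Topology.IsInducing (orbitClosure H E) := by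
  refine Topology.isInducing_iff_nhds.2 fun q => ?_
  induction q using Quotient.inductionOn with | h x
  have hmk : IsOpenQuotientMap (Quotient.mk (orbitRel H E)) := isOpenQuotientMap_quotientMk
  rw [← hmk.map_nhds_eq]
  refine (nhds_basis_eball.map _).eq_of_same_basis ?_
  simpa only [preimage_orbitClosure_eball] using
    (nhds_basis_eball (x := orbitClosure H E ⟦x⟧)).comap (orbitClosure H E)

theorem HasSeparatedOrbits.metrizableSpace_quotient (hsep : HasSeparatedOrbits H E) :
    MetrizableSpace (Quotient (orbitRel H E)) :=
  Topology.IsEmbedding.metrizableSpace ⟨isInducing_orbitClosure, hsep.injective_orbitClosure⟩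

theorem mk_eq_mk_of_dist_smul_lt {x y : E} {ε : ℝ}
    (hε : ∀ h : H, dist x (h • x) < ε → x = h • x) {g h : H} (hg : dist y (g • x) < ε / 2)
    (hh : dist y (h • x) < ε / 2) : (g : H ⧸ stabilizer H x) = h := by
  rw [QuotientGroup.eq, mem_stabilizer_iff]
  refine (hε _ ?_).symm
  calc dist x ((g⁻¹ * h) • x) = dist (g • x) (h • x) := by
        rw [← dist_smul g, mul_smul, smul_inv_smul]
    _ ≤ dist y (g • x) + dist y (h • x) := dist_triangle_left _ _ _
    _ < ε := by linarith

theorem HasSeparatedOrbits.isProperAction (hsep : HasSeparatedOrbits H E)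
    (hfin : ∀ x : E, (stabilizer H x : Set H).Finite) : IsProperAction H E where
  continuous_smul h := (isometry_smul E h).continuous
  slice x := by
    obtain ⟨ε, hε, hεx⟩ := hsep x x
    let U : Set E := ⋃ h : H, ball (h • x) (ε / 2)
    choose c hc using fun u : U => Set.mem_iUnion.1 u.2
    have hU : ∀ h : H, ∀ u ∈ U, h • u ∈ U := fun h u hu =>
      Set.mem_iUnion.2 ⟨h * c ⟨u, hu⟩, by rw [mem_ball, mul_smul, dist_smul]; exact hc ⟨u, hu⟩⟩
    refine ⟨U, isOpen_iUnion fun _ => isOpen_ball,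
      Set.mem_iUnion.2 ⟨1, by simpa using hε⟩, hU, stabilizer H x, hfin x, fun u => c u, ?_, ?_⟩
    · refine IsLocallyConstant.iff_exists_open _ |>.2 fun u => ?_
      exact ⟨{y : U | dist y.1 (c u • x) < ε / 2}, isOpen_ball.preimage continuous_subtype_val,
        hc u, fun y hy => mk_eq_mk_of_dist_smul_lt hεx (hc y) hy⟩
    · intro h u hu
      refine mk_eq_mk_of_dist_smul_lt hεx (h := h * c u) (hc ⟨h • u.1, hu⟩) ?_
      rw [mul_smul, dist_smul]
      exact hc u

end IsometricAction

/-! ### Convexly embedded spaces -/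

section ConvexEmbedding

open MulAction

/-- The pullback of a partition of unity under a continuous map. -/
def partitionOfUnityComap {κ Y Z : Type*} [TopologicalSpace Y] [TopologicalSpace Z]
    (ρ : PartitionOfUnity κ Y) (π : C(Z, Y)) : PartitionOfUnity κ Z where
  toFun i := (ρ i).comp π
  locallyFinite' := ρ.locallyFinite.preimage_continuous π.continuous
  nonneg' i z := ρ.nonneg i (π z)
  sum_eq_one' z _ := ρ.sum_eq_one (Set.mem_univ (π z))
  sum_le_one' z := ρ.sum_le_one (π z)

theorem exists_invariant_partitionOfUnity {H Z κ : Type*} [Group H] [TopologicalSpace Z]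
    [MulAction H Z] [ContinuousConstSMul H Z] [T2Space (Quotient (orbitRel H Z))]
    [ParacompactSpace (Quotient (orbitRel H Z))] {U : κ → Set Z} (hU : ∀ i, IsOpen (U i))
    (hinv : ∀ (i : κ) (h : H), ∀ z ∈ U i, h • z ∈ U i) (hcover : ∀ z, ∃ i, z ∈ U i) :
    ∃ ρ : PartitionOfUnity κ Z, ρ.IsSubordinate U ∧
      ∀ (i : κ) (h : H) (z : Z), ρ i (h • z) = ρ i z := by
  let π : C(Z, Quotient (orbitRel H Z)) := ⟨Quotient.mk _, continuous_quotient_mk'⟩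
  have hsat (i : κ) (z : Z) (hz : π z ∈ π '' U i) : z ∈ U i := by
    obtain ⟨y, hy, hyz⟩ := hz
    obtain ⟨h, rfl⟩ := Quotient.exact hyz
    simpa using hinv i h⁻¹ _ hy
  obtain ⟨ρ, hρ⟩ := PartitionOfUnity.exists_isSubordinate isClosed_univ (fun i => π '' U i)
    (fun i => isOpenMap_quotient_mk'_mul _ (hU i)) fun q _ => by
      induction q using Quotient.inductionOn with | h z
      obtain ⟨i, hi⟩ := hcover z
      exact Set.mem_iUnion.2 ⟨i, z, hi, rfl⟩
  refine ⟨partitionOfUnityComap ρ π, fun i z hz => hsat i z (hρ i ?_), fun i h z =>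
    congrArg (ρ i) (Quotient.sound ⟨h, rfl⟩)⟩
  exact tsupport_comp_subset_preimage (ρ i) π.continuous hz

/-- A convex embedding of an `H`-space into a topological vector space: a topological embedding
with convex image through which every element of `H` acts affinely. Both properties are encoded in
the convexity of the graphs of the elements of `H`. -/
structure IsConvexEmbedding (H : Type*) {E W : Type*} [Group H] [TopologicalSpace E]
    [MulAction H E] [TopologicalSpace W] [AddCommGroup W] [Module ℝ W] (ι : E → W) : Prop where
  isEmbedding : Topology.IsEmbedding ι
  convex_graph : ∀ h : H, Convex ℝ (Set.range fun x => (ι x, ι (h • x)))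

namespace IsConvexEmbedding

variable {H E W : Type*} [Group H] [TopologicalSpace E] [MulAction H E] [TopologicalSpace W]
  [AddCommGroup W] [Module ℝ W] {ι : E → W} (hι : IsConvexEmbedding H ι)

include hι

theorem convex_range : Convex ℝ (Set.range ι) := by
  have h := (hι.convex_graph 1).linear_image (LinearMap.fst ℝ W W)
  rwa [← Set.range_comp] at h

theorem eq_smul_of_sum {κ : Type*} {s : Finset κ} {c : κ → ℝ} (hc₀ : ∀ i ∈ s, 0 ≤ c i)
    (hc₁ : ∑ i ∈ s, c i = 1) {x : κ → E} {y z : E} {h : H} (hy : ι y = ∑ i ∈ s, c i • ι (x i))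
    (hz : ι z = ∑ i ∈ s, c i • ι (h • x i)) : z = h • y := by
  obtain ⟨w, hw⟩ := (hι.convex_graph h).sum_mem hc₀ hc₁ fun i _ => Set.mem_range_self (x i)
  simp only [Prod.ext_iff, Prod.fst_sum, Prod.snd_sum, Prod.smul_mk, ← hy, ← hz] at hw
  obtain rfl := hι.isEmbedding.injective hw.1
  exact (hι.isEmbedding.injective hw.2).symm

theorem exists_continuousMap {Z : Type*} [TopologicalSpace Z] {f : Z → W} (hf : Continuous f)
    (hmem : ∀ z, f z ∈ Set.range ι) : ∃ F : C(Z, E), ∀ z, ι (F z) = f z := by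
  choose F hF using hmem
  exact ⟨⟨F, hι.isEmbedding.continuous_iff.2 ((funext hF : ι ∘ F = f) ▸ hf)⟩, hF⟩

theorem exists_fixedPoint [Nonempty E] {K : Subgroup H} (hK : (K : Set H).Finite) :
    ∃ x : E, K ≤ stabilizer H x := by
  have := hK.fintype
  obtain ⟨x₀⟩ := ‹Nonempty E›
  have hc : ∑ _k : K, (Fintype.card K : ℝ)⁻¹ = 1 := by simp
  obtain ⟨x, hx⟩ := hι.convex_range.sum_mem (t := Finset.univ) (fun _ _ => by positivity) hc
    fun (k : K) _ => Set.mem_range_self (k • x₀)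
  refine ⟨x, fun k hk => (hι.eq_smul_of_sum (fun _ _ => by positivity) hc hx ?_).symm⟩
  rw [hx]
  refine (Fintype.sum_equiv (Equiv.mulLeft ⟨k, hk⟩) _ _ fun l => ?_).symm
  rw [Equiv.coe_mulLeft, mul_smul]
  rfl

variable {Z : Type*} [TopologicalSpace Z] [MulAction H Z]

theorem exists_local_equivariant_map [Nonempty E] (hZ : IsProperAction H Z) (z : Z) :
    ∃ U : Set Z, IsOpen U ∧ z ∈ U ∧ (∀ h : H, ∀ u ∈ U, h • u ∈ U) ∧
      ∃ f : Z → E, ContinuousOn f U ∧ ∀ h : H, ∀ u ∈ U, f (h • u) = h • f u := by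
  classical
  obtain ⟨U, hU, hz, hinv, K, hK, ρ, hρ, hρeq⟩ := hZ.slice z
  obtain ⟨x, hx⟩ := hι.exists_fixedPoint hK
  let e : H ⧸ K → E := fun q => ofQuotientStabilizer H x (Subgroup.quotientMapOfLE hx q)
  have he (h : H) (q : H ⧸ K) : e (h • q) = h • e q := by
    induction q using QuotientGroup.induction_on
    exact mul_smul _ _ _
  let f : Z → E := fun u => if hu : u ∈ U then e (ρ ⟨u, hu⟩) else x
  have hf (u : U) : f u = e (ρ u) := dif_pos u.2
  refine ⟨U, hU, hz, hinv, f, ?_, fun h u hu => ?_⟩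
  · rw [continuousOn_iff_continuous_domRestrict]
    exact (funext hf : U.domRestrict f = e ∘ ρ) ▸ (hρ.comp e).continuous
  · rw [hf ⟨u, hu⟩, hf ⟨h • u, hinv h u hu⟩, hρeq h ⟨u, hu⟩, he]

variable [ContinuousSMul ℝ W] [ContinuousAdd W]

theorem exists_equivariant_map_of_partitionOfUnity {κ : Type*} {ρ : PartitionOfUnity κ Z}
    (hρ : ∀ (i : κ) (h : H) (z : Z), ρ i (h • z) = ρ i z) {U : κ → Set Z}
    (hρU : ρ.IsSubordinate U) (hU : ∀ i, IsOpen (U i)) {f : κ → Z → E}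
    (hf : ∀ i, ContinuousOn (f i) (U i))
    (hfeq : ∀ (i : κ) (h : H), ∀ z ∈ U i, f i (h • z) = h • f i z) :
    ∃ F : C(Z, E), ∀ (h : H) (z : Z), F (h • z) = h • F z := by
  obtain ⟨F, hF⟩ := hι.exists_continuousMap
    (hρU.continuous_finsum_smul hU fun i => hι.isEmbedding.continuous.comp_continuousOn (hf i))
    fun z => ρ.finsum_smul_mem_convex (Set.mem_univ z) (fun i _ => ⟨f i z, rfl⟩) hι.convex_range
  have hFsum (z : Z) : ι (F z) = ∑ i ∈ ρ.finsupport z, ρ i z • ι (f i z) :=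
    (hF z).trans (ρ.sum_finsupport_smul_eq_finsum fun i z => ι (f i z)).symm
  refine ⟨F, fun h z => hι.eq_smul_of_sum (fun i _ => ρ.nonneg i z)
    (ρ.sum_finsupport (Set.mem_univ z)) (hFsum z) ?_⟩
  have hsupp : ρ.finsupport (h • z) = ρ.finsupport z := by
    ext i
    simp only [ρ.mem_finsupport, Function.mem_support, hρ]
  rw [hFsum, hsupp]
  refine Finset.sum_congr rfl fun i hi => ?_
  have hz : z ∈ U i := hρU i (subset_tsupport _ ((ρ.mem_finsupport z).1 hi))
  rw [hρ, hfeq i h z hz]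

theorem exists_equivariant_map [Nonempty E] (hZ : IsProperAction H Z)
    [T2Space (Quotient (orbitRel H Z))] [ParacompactSpace (Quotient (orbitRel H Z))] :
    ∃ F : C(Z, E), ∀ (h : H) (z : Z), F (h • z) = h • F z := by
  have : ContinuousConstSMul H Z := ⟨hZ.continuous_smul⟩
  choose U hU hzU hinv f hf hfeq using hι.exists_local_equivariant_map hZ
  obtain ⟨ρ, hρU, hρ⟩ := exists_invariant_partitionOfUnity hU hinv fun z => ⟨z, hzU z⟩
  exact hι.exists_equivariant_map_of_partitionOfUnity hρ hρU hU hf hfeq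

theorem exists_equivariant_homotopy (f₀ f₁ : C(Z, E))
    (h₀ : ∀ (h : H) (z : Z), f₀ (h • z) = h • f₀ z)
    (h₁ : ∀ (h : H) (z : Z), f₁ (h • z) = h • f₁ z) :
    ∃ F : f₀.Homotopy f₁, ∀ (t : unitInterval) (h : H) (z : Z), F (t, h • z) = h • F (t, z) := by
  have hcont := hι.isEmbedding.continuous
  obtain ⟨F, hF⟩ := hι.exists_continuousMap (Z := unitInterval × Z)
    (f := fun p => (1 - p.1 : ℝ) • ι (f₀ p.2) + (p.1 : ℝ) • ι (f₁ p.2)) (by fun_prop)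
    fun p => hι.convex_range ⟨_, rfl⟩ ⟨_, rfl⟩ (sub_nonneg.2 p.1.2.2) p.1.2.1 (by ring)
  refine ⟨⟨F, fun z => hι.isEmbedding.injective ?_, fun z => hι.isEmbedding.injective ?_⟩,
    fun t h z => hι.eq_smul_of_sum (s := Finset.univ) (c := ![(1 - t : ℝ), t])
      (x := ![f₀ z, f₁ z]) ?_ (by simp) ?_ ?_⟩
  · exact (hF (0, z)).trans (by simp)
  · exact (hF (1, z)).trans (by simp)
  · simp [Fin.forall_fin_two, t.2.1, t.2.2]
  · exact (hF (t, z)).trans (by simp)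
  · exact (hF (t, h • z)).trans (by simp [h₀, h₁])

end IsConvexEmbedding

theorem isModelEUnderline_of_isConvexEmbedding {H : Type v} {E : Type w} {W : Type*} [Group H]
    [MetricSpace E] [Nonempty E] [MulAction H E] [IsIsometricSMul H E] [TopologicalSpace W]
    [AddCommGroup W] [Module ℝ W] [ContinuousSMul ℝ W] [ContinuousAdd W] {ι : E → W}
    (hι : IsConvexEmbedding H ι) (hsep : HasSeparatedOrbits H E)
    (hfin : ∀ x : E, (stabilizer H x : Set H).Finite) : IsModelEUnderline.{u} H E where
  proper := hsep.isProperAction hfin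
  metrizable := inferInstance
  metrizable_quotient := hsep.metrizableSpace_quotient
  exists_map _ _ _ hZ _ _ := hι.exists_equivariant_map hZ
  homotopic _ _ _ _ _ _ := hι.exists_equivariant_homotopy

end ConvexEmbedding

/-! ### The linear embedding of `X` -/

section Embedding

variable {ω : ℕ → Fin 3}

theorem X.finite_ne_indicator (φ : X) : {x | φ.1 x ≠ ΓPlus.indicator 1 x}.Finite :=
  ((mem_X_iff _).1 φ.2).2

instance : Nonempty X :=
  ⟨⟨ΓPlus.indicator 1, (mem_X_iff _).2 ⟨fun x => by by_cases h : x ∈ ΓPlus <;> simp [h], by simp⟩⟩⟩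

/-- The embedding of `X` into a Hilbert space that takes the vertex `Γ₊` to the origin. -/
noncomputable def toL2 (φ : X) : lp (fun _ : V => ℝ) 2 :=
  ⟨fun x => φ.1 x - ΓPlus.indicator 1 x, memℓp_gen <| summable_of_hasFiniteSupport <|
    φ.finite_ne_indicator.subset fun x hx h => hx (by simp [h])⟩

theorem toL2_apply (φ : X) (x : V) : toL2 φ x = φ.1 x - ΓPlus.indicator 1 x := rfl

theorem toL2_sub_apply (φ ψ : X) (x : V) : (toL2 φ - toL2 ψ) x = φ.1 x - ψ.1 x := by
  rw [lp.coeFn_sub, Pi.sub_apply, toL2_apply, toL2_apply, sub_sub_sub_cancel_right]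

theorem isometry_toL2 : Isometry toL2 := by
  refine Isometry.of_dist_eq fun φ ψ => ?_
  rw [dist_eq_euclid, dist_eq_norm, lp.norm_eq_tsum_rpow (by norm_num), euclid, Real.sqrt_eq_rpow]
  simp only [toL2_sub_apply, ENNReal.toReal_ofNat, Real.rpow_ofNat, Real.norm_eq_abs, sq_abs]
  rw [tsum_eq_finsum ((finite_ne φ ψ).subset fun x hx h => hx (by simp [h]))]

theorem X.exists_convexCombination (φ ψ : X) {s t : ℝ} (hs : 0 ≤ s) (ht : 0 ≤ t)
    (hst : s + t = 1) : ∃ χ : X, ∀ x, χ.1 x = s * φ.1 x + t * ψ.1 x := by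
  refine ⟨⟨fun x => s * φ.1 x + t * ψ.1 x, (mem_X_iff _).2 ⟨fun x => ?_, ?_⟩⟩, fun x => rfl⟩
  · exact convex_Icc (0 : ℝ) 1 (((mem_X_iff _).1 φ.2).1 x) (((mem_X_iff _).1 ψ.2).1 x) hs ht hst
  · refine (φ.finite_ne_indicator.union ψ.finite_ne_indicator).subset fun x hx => ?_
    by_contra! hc
    simp only [Set.mem_union, Set.mem_ofPred_eq, not_or, not_not] at hc
    exact hx (by rw [hc.1, hc.2, ← add_mul, hst, one_mul])

theorem toL2_eq_of_convexCombination {φ ψ χ : X} {s t : ℝ} (hst : s + t = 1)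
    (hχ : ∀ x, χ.1 x = s * φ.1 x + t * ψ.1 x) : toL2 χ = s • toL2 φ + t • toL2 ψ := by
  ext x
  simp only [lp.coeFn_add, lp.coeFn_smul, Pi.add_apply, Pi.smul_apply, smul_eq_mul, toL2_apply, hχ]
  linear_combination (ΓPlus.indicator 1 x : ℝ) * hst

variable (ω) in
theorem isConvexEmbedding_toL2 : IsConvexEmbedding (G ω) toL2 where
  isEmbedding := isometry_toL2.isEmbedding
  convex_graph g := by
    rintro _ ⟨φ, rfl⟩ _ ⟨ψ, rfl⟩ s t hs ht hst
    obtain ⟨χ, hχ⟩ := φ.exists_convexCombination ψ hs ht hst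
    exact ⟨χ, Prod.ext (toL2_eq_of_convexCombination hst hχ)
      (toL2_eq_of_convexCombination hst fun x => hχ (g⁻¹ • x))⟩

instance : IsIsometricSMul (G ω) X where
  isometry_smul g := Isometry.of_dist_eq fun φ ψ => by
    rw [dist_eq_euclid, dist_eq_euclid, euclid, euclid]
    exact congrArg Real.sqrt (finsum_comp_equiv (MulAction.toPerm g⁻¹ : Equiv.Perm V)
      (f := fun x => (φ.1 x - ψ.1 x) ^ 2))

theorem abs_sub_le_dist (φ ψ : X) (x : V) : |φ.1 x - ψ.1 x| ≤ dist φ ψ := by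
  have h := lp.norm_apply_le_norm two_ne_zero (toL2 φ - toL2 ψ) x
  rwa [toL2_sub_apply, ← dist_eq_norm (toL2 φ), isometry_toL2.dist_eq] at h

theorem X.finite_range (φ : X) : (Set.range φ.1).Finite := by
  refine ((φ.finite_ne_indicator.image φ.1).union (Set.toFinite {0, 1})).subset ?_
  rintro _ ⟨x, rfl⟩
  by_cases h : φ.1 x = ΓPlus.indicator 1 x
  · right
    by_cases hx : x ∈ ΓPlus <;> simp [h, hx]
  · exact Or.inl ⟨x, h, rfl⟩

variable (ω) in
theorem hasSeparatedOrbits : HasSeparatedOrbits (G ω) X := by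
  intro φ ψ
  -- All points of the orbit of `ψ` have the same finite set of coordinates.
  let D : Set ℝ := Set.image2 (· - ·) (Set.range φ.1) (Set.range ψ.1) \ {0}
  have hD : D.Finite := (φ.finite_range.image2 _ ψ.finite_range).sdiff
  obtain ⟨ε, hε, hball⟩ := Metric.mem_nhds_iff.1
    (hD.isClosed.isOpen_compl.mem_nhds (x := 0) fun h => h.2 rfl)
  refine ⟨ε, hε, fun g hg => Subtype.ext (funext fun x => ?_)⟩
  by_contra hne
  refine hball (a := φ.1 x - (g • ψ).1 x) ?_
    ⟨⟨_, ⟨x, rfl⟩, _, ⟨g⁻¹ • x, rfl⟩, rfl⟩, sub_ne_zero.2 hne⟩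
  rw [mem_ball_zero_iff, Real.norm_eq_abs]
  exact (abs_sub_le_dist _ _ x).trans_lt hg

end Embedding

/-! ### Sections of tree automorphisms -/

section Sections

/-- The first letter of the image under `g` of the words that start with `b`. -/
def rootMap (g : TreeAut) (b : Bool) : Bool := (g.1 [b]).headD false

theorem apply_singleton (g : TreeAut) (b : Bool) : g.1 [b] = [rootMap g b] := by
  obtain ⟨c, hc⟩ := List.length_eq_one_iff.1 (g.2.1 [b])
  rw [rootMap, hc, List.headD_cons]

theorem apply_cons (g : TreeAut) (b : Bool) (w : List Bool) :
    g.1 (b :: w) = rootMap g b :: (g.1 (b :: w)).tail := by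
  obtain ⟨t, ht⟩ := (g.2.2 [b] (b :: w)).2 ⟨w, rfl⟩
  rw [← ht, apply_singleton]
  rfl

theorem rootMap_mul (g h : TreeAut) (b : Bool) : rootMap (g * h) b = rootMap g (rootMap h b) := by
  have hgh : (g * h).1 [b] = g.1 (h.1 [b]) := rfl
  simpa only [apply_singleton, List.cons.injEq, and_true] using hgh

theorem rootMap_inv_rootMap (g : TreeAut) (b : Bool) : rootMap g⁻¹ (rootMap g b) = b := by
  rw [← rootMap_mul, inv_mul_cancel]
  rfl

theorem rootMap_eq_xor (g : TreeAut) (b : Bool) : rootMap g b = (b ^^ rootMap g false) := by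
  have hinj : rootMap g true ≠ rootMap g false := fun h =>
    Bool.false_ne_true.symm (Function.LeftInverse.injective (rootMap_inv_rootMap g) h)
  cases b
  · simp
  · simpa using Bool.eq_not.2 hinj

theorem tail_inv_apply_tail_apply (g : TreeAut) (b : Bool) (w : List Bool) :
    ((g⁻¹).1 (rootMap g b :: (g.1 (b :: w)).tail)).tail = w := by
  rw [← apply_cons]
  exact congrArg List.tail (g.1.symm_apply_apply (b :: w))

/-- The section of `g` at the vertex `b` of the first level: `g (b w) = g(b) (sec g b w)`. -/
def sec (g : TreeAut) (b : Bool) : TreeAut :=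
  ⟨{ toFun := fun w => (g.1 (b :: w)).tail
     invFun := fun w => ((g⁻¹).1 (rootMap g b :: w)).tail
     left_inv := tail_inv_apply_tail_apply g b
     right_inv := fun w => by
      have h := tail_inv_apply_tail_apply g⁻¹ (rootMap g b) w
      rwa [rootMap_inv_rootMap, inv_inv] at h }, by
    refine ⟨fun u => ?_, fun u v => ?_⟩
    · exact (List.length_tail ..).trans (congrArg (· - 1) (g.2.1 (b :: u)))
    · have h := g.2.2 (b :: u) (b :: v)
      rwa [apply_cons, apply_cons g b v, List.prefix_cons_inj, List.prefix_cons_inj] at h⟩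

theorem apply_cons_sec (g : TreeAut) (b : Bool) (w : List Bool) :
    g.1 (b :: w) = rootMap g b :: (sec g b).1 w := apply_cons g b w

theorem treeAut_ext {g h : TreeAut} (hr : ∀ b, rootMap g b = rootMap h b)
    (hs : ∀ b, sec g b = sec h b) : g = h := by
  refine Subtype.ext (Equiv.ext ?_)
  rintro (_ | ⟨b, w⟩)
  · rw [List.length_eq_zero_iff.1 (g.2.1 []), List.length_eq_zero_iff.1 (h.2.1 [])]
  · rw [apply_cons_sec, apply_cons_sec, hr, hs]

theorem sec_one (b : Bool) : sec 1 b = 1 := rfl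

theorem sec_mul (g h : TreeAut) (b : Bool) :
    sec (g * h) b = sec g (rootMap h b) * sec h b := by
  refine Subtype.ext (Equiv.ext fun w => ?_)
  have hgh : (g * h).1 (b :: w) = g.1 (h.1 (b :: w)) := rfl
  rw [apply_cons_sec, apply_cons_sec, apply_cons_sec] at hgh
  exact (List.cons.inj hgh).2

theorem rootMap_aAut (b : Bool) : rootMap aAut b = !b := rfl

theorem sec_aAut (b : Bool) : sec aAut b = 1 := rfl

theorem rootMap_genAut (i : Fin 3) (ω : ℕ → Fin 3) (b : Bool) : rootMap (genAut i ω) b = b := by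
  change (genFun i ω [b]).headD false = b
  cases b
  · by_cases h : ω 0 = i <;> simp [genFun, h]
  · simp [genFun]

theorem sec_genAut_true (i : Fin 3) (ω : ℕ → Fin 3) :
    sec (genAut i ω) true = genAut i (shift ω) := rfl

theorem sec_genAut_false (i : Fin 3) (ω : ℕ → Fin 3) :
    sec (genAut i ω) false = if ω 0 = i then 1 else aAut := by
  refine Subtype.ext (Equiv.ext fun w => ?_)
  change (genFun i ω (false :: w)).tail = _
  by_cases h : ω 0 = i
  · simp [genFun, h]
  · simp only [genFun, h, if_false]
    rfl

end Sections

section GrigorchukGroup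

variable {ω : ℕ → Fin 3}

theorem aAut_mem_G : aAut ∈ G ω := Subgroup.subset_closure (by simp [gens])

theorem genAut_mem_G (i : Fin 3) : genAut i ω ∈ G ω := Subgroup.subset_closure (genAut_mem i ω)

theorem eq_aAut_or_genAut_of_mem_gens {s : TreeAut} (hs : s ∈ gens ω) :
    s = aAut ∨ ∃ i, s = genAut i ω := by
  simp only [gens, Set.mem_insert_iff, Set.mem_singleton_iff] at hs
  rcases hs with rfl | rfl | rfl | rfl
  · exact Or.inl rfl
  all_goals exact Or.inr ⟨_, rfl⟩

theorem aAut_mul_self : aAut * aAut = 1 :=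
  gens_mul_self (ω := fun _ => 0) (by simp [gens])

theorem genAut_mul_self (i : Fin 3) : genAut i ω * genAut i ω = 1 :=
  gens_mul_self (genAut_mem i ω)

/- Inverses need no case, since the generators are involutions. -/
@[elab_as_elim]
theorem G_induction {p : (g : TreeAut) → g ∈ G ω → Prop} (one : p 1 (one_mem _))
    (a : p aAut aAut_mem_G) (gen : ∀ i, p (genAut i ω) (genAut_mem_G i))
    (mul : ∀ g h hg hh, p g hg → p h hh → p (g * h) (mul_mem hg hh)) {g : TreeAut}
    (hg : g ∈ G ω) : p g hg := by
  have hgen (s : TreeAut) (hs : s ∈ gens ω) : p s (Subgroup.subset_closure hs) := by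
    rcases eq_aAut_or_genAut_of_mem_gens hs with rfl | ⟨i, rfl⟩
    exacts [a, gen i]
  refine Subgroup.closure_induction'' hgen (fun s hs => ?_) one mul hg
  simpa only [inv_eq_of_mul_eq_one_left (gens_mul_self hs)] using hgen s hs

theorem sec_mem_G {g : TreeAut} (hg : g ∈ G ω) (b : Bool) : sec g b ∈ G (shift ω) := by
  induction hg using G_induction generalizing b with
  | one => exact one_mem _
  | a => exact one_mem _
  | gen i =>
    cases b
    · rw [sec_genAut_false]
      split_ifs
      exacts [one_mem _, aAut_mem_G]
    · exact genAut_mem_G i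
  | mul g h _ _ ihg ihh =>
    rw [sec_mul]
    exact mul_mem (ihg _) (ihh _)

end GrigorchukGroup

/-! ### The half-line `Γ₊` in terms of the last letter `1` -/

section LastOne

/-- The sequence with first letter `b`, followed by `y`. -/
def V.cons (b : Bool) (y : V) : V :=
  ⟨fun n => Nat.casesOn n b y.1, ((y.2.image Nat.succ).insert 0).subset <| by
    rintro (_ | n) hn
    exacts [Or.inl rfl, Or.inr ⟨n, hn, rfl⟩]⟩

theorem V.exists_eq_cons (x : V) : ∃ y, x = V.cons (x.1 0) y :=
  ⟨⟨fun n => x.1 (n + 1), x.2.preimage (add_left_injective 1).injOn⟩,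
    Subtype.ext <| funext fun n => by cases n <;> rfl⟩

theorem V.cons_eq_zeroSeq {b : Bool} {y : V} :
    V.cons b y = zeroSeq ↔ b = false ∧ y = zeroSeq := by
  refine ⟨fun h => ⟨congrFun (congrArg Subtype.val h) 0, Subtype.ext <| funext fun n =>
    congrFun (congrArg Subtype.val h) (n + 1)⟩, ?_⟩
  rintro ⟨rfl, rfl⟩
  exact Subtype.ext <| funext fun n => by cases n <;> rfl

theorem V.flip_zero_cons (b : Bool) (y : V) : V.flip 0 (V.cons b y) = V.cons (!b) y :=
  Subtype.ext <| funext fun n => by cases n <;> rfl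

theorem V.flip_succ_cons (k : ℕ) (b : Bool) (y : V) :
    V.flip (k + 1) (V.cons b y) = V.cons b (V.flip k y) :=
  Subtype.ext <| funext fun n => by cases n <;> simp [V.flip, GrigorchukCube.flip, V.cons]

/-- The sequences whose last letter `1` is preceded by an even number of letters. -/
def lastOneEven : Set V := {x | ∃ n, IsGreatest {m | x.1 m = true} n ∧ Even n}

theorem zeroSeq_notMem_lastOneEven : zeroSeq ∉ lastOneEven := fun ⟨_, h, _⟩ =>
  Bool.false_ne_true h.1

theorem V.exists_isGreatest {x : V} (hx : x ≠ zeroSeq) : ∃ n, IsGreatest {m | x.1 m = true} n := by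
  obtain ⟨n, hn, hmax⟩ := Set.exists_max_image _ id x.2 <| Set.nonempty_iff_ne_empty.2 fun h =>
    hx <| Subtype.ext <| funext fun m => Bool.eq_false_iff.2 (Set.eq_empty_iff_forall_notMem.1 h m)
  exact ⟨n, hn, hmax⟩

theorem V.isGreatest_cons {b : Bool} {y : V} {n : ℕ} (h : IsGreatest {m | y.1 m = true} n) :
    IsGreatest {m | (V.cons b y).1 m = true} (n + 1) :=
  ⟨h.1, by
    rintro (_ | m) hm
    exacts [Nat.zero_le _, Nat.succ_le_succ (h.2 hm)]⟩

theorem V.cons_mem_lastOneEven {y : V} (hy : y ≠ zeroSeq) (b : Bool) :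
    V.cons b y ∈ lastOneEven ↔ y ∉ lastOneEven := by
  obtain ⟨n, hn⟩ := V.exists_isGreatest hy
  have mem_iff {x : V} {k : ℕ} (hk : IsGreatest {m | x.1 m = true} k) :
      x ∈ lastOneEven ↔ Even k :=
    ⟨fun ⟨_, hm, he⟩ => hm.unique hk ▸ he, fun he => ⟨k, hk, he⟩⟩
  rw [mem_iff hn, mem_iff (V.isGreatest_cons hn), Nat.even_add_one]

theorem V.cons_true_mem_lastOneEven (y : V) : V.cons true y ∈ lastOneEven ↔ y ∉ lastOneEven := by
  rcases eq_or_ne y zeroSeq with rfl | hy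
  · refine iff_of_true ⟨0, ⟨rfl, ?_⟩, Even.zero⟩ zeroSeq_notMem_lastOneEven
    rintro (_ | m) hm
    exacts [le_rfl, absurd hm Bool.false_ne_true]
  · exact V.cons_mem_lastOneEven hy true

theorem V.cons_false_mem_lastOneEven (y : V) :
    V.cons false y ∈ lastOneEven ↔ y ∉ insert zeroSeq lastOneEven := by
  rcases eq_or_ne y zeroSeq with rfl | hy
  · rw [V.cons_eq_zeroSeq.2 ⟨rfl, rfl⟩]
    exact iff_of_false zeroSeq_notMem_lastOneEven (not_not.2 (Set.mem_insert _ _))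
  · rw [V.cons_mem_lastOneEven hy, Set.mem_insert_iff, or_iff_right hy]

theorem V.cons_mem_insert_lastOneEven (b : Bool) (y : V) :
    V.cons b y ∈ insert zeroSeq lastOneEven ↔ y ∉ lastOneEven := by
  cases b
  · rw [Set.mem_insert_iff, V.cons_eq_zeroSeq, V.cons_false_mem_lastOneEven, Set.mem_insert_iff]
    have := zeroSeq_notMem_lastOneEven
    by_cases hy : y = zeroSeq <;> simp_all
  · rw [Set.mem_insert_iff, V.cons_eq_zeroSeq, V.cons_true_mem_lastOneEven]
    simp

theorem V.flip_zero_mem_iff (x : V) :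
    V.flip 0 x ∈ insert zeroSeq lastOneEven ↔ x ∈ insert zeroSeq lastOneEven := by
  obtain ⟨y, hy⟩ := x.exists_eq_cons
  rw [hy, V.flip_zero_cons, V.cons_mem_insert_lastOneEven, V.cons_mem_insert_lastOneEven]

theorem V.flip_succ_mem_iff {x : V} {k : ℕ} (h : FirstZero x.1 k) :
    V.flip (k + 1) x ∈ lastOneEven ↔ x ∈ lastOneEven := by
  induction k generalizing x with
  | zero =>
    obtain ⟨y, hy⟩ := x.exists_eq_cons
    rw [hy, h.2, V.flip_succ_cons, V.cons_false_mem_lastOneEven, V.cons_false_mem_lastOneEven,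
      V.flip_zero_mem_iff]
  | succ k ih =>
    obtain ⟨y, hy⟩ := x.exists_eq_cons
    rw [h.1 0 k.succ_pos] at hy
    subst hy
    have hfirst : FirstZero y.1 k := ⟨fun j hj => h.1 (j + 1) (Nat.succ_lt_succ hj), h.2⟩
    rw [V.flip_succ_cons, V.cons_true_mem_lastOneEven, V.cons_true_mem_lastOneEven, ih hfirst]

theorem mem_lastOneEven_iff_of_adj {x y : V} (h : Γ.Adj x y) (hx : x ≠ zeroSeq)
    (hy : y ≠ zeroSeq) : x ∈ lastOneEven ↔ y ∈ lastOneEven := by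
  rcases h with rfl | ⟨k, hk, rfl⟩
  · simpa only [Set.mem_insert_iff, hx, hy, false_or] using (V.flip_zero_mem_iff x).symm
  · exact (V.flip_succ_mem_iff hk).symm

theorem mem_lastOneEven_iff_of_walk {x y : V} (p : Γ.Walk x y) (hp : zeroSeq ∉ p.support) :
    x ∈ lastOneEven ↔ y ∈ lastOneEven := by
  induction p with
  | nil => rfl
  | cons h p ih =>
    rw [SimpleGraph.Walk.support_cons, List.mem_cons, not_or] at hp
    exact (mem_lastOneEven_iff_of_adj h (Ne.symm hp.1)
      fun hw => hp.2 (hw ▸ p.start_mem_support)).trans (ih hp.2)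

theorem oneSeq_mem_lastOneEven : oneSeq ∈ lastOneEven :=
  ((V.flip_zero_mem_iff zeroSeq).2 (Set.mem_insert _ _)).resolve_left fun h =>
    Bool.false_ne_true (congrFun (congrArg Subtype.val h) 0).symm

theorem ΓPlus_eq_insert : ΓPlus = insert zeroSeq lastOneEven := by
  refine Set.ext fun x => or_congr_right ⟨fun ⟨p, hp⟩ =>
    (mem_lastOneEven_iff_of_walk p hp).1 oneSeq_mem_lastOneEven, fun hx => ?_⟩
  obtain ⟨n, hn, -⟩ := id hx
  obtain ⟨p, hp⟩ := (reachable_of_agree (n + 1) zeroSeq x fun m hm =>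
    (Bool.eq_false_iff.2 fun h => (hn.2 h).not_gt hm).symm).exists_isPath
  cases p with
  | nil => exact absurd hx zeroSeq_notMem_lastOneEven
  | cons h q =>
    rw [SimpleGraph.Walk.cons_isPath_iff] at hp
    rcases h with rfl | ⟨k, hk, rfl⟩
    · exact ⟨q, hp.2⟩
    · exact absurd ((V.flip_succ_mem_iff hk).1 ((mem_lastOneEven_iff_of_walk q hp.2).2 hx))
        zeroSeq_notMem_lastOneEven

theorem preimage_cons_true_lastOneEven : V.cons true ⁻¹' lastOneEven = lastOneEvenᶜ :=
  Set.ext V.cons_true_mem_lastOneEven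

theorem preimage_cons_false_lastOneEven : V.cons false ⁻¹' lastOneEven = ΓPlusᶜ := by
  rw [ΓPlus_eq_insert]
  exact Set.ext V.cons_false_mem_lastOneEven

theorem preimage_cons_ΓPlus (b : Bool) : V.cons b ⁻¹' ΓPlus = lastOneEvenᶜ := by
  rw [ΓPlus_eq_insert]
  exact Set.ext (V.cons_mem_insert_lastOneEven b)

end LastOne

section Stabilizers

open scoped Pointwise
open MulAction

variable {ω : ℕ → Fin 3}

/-- The section of an element of `G ω`, as an element of `G (shift ω)`. -/
def secG (g : G ω) (b : Bool) : G (shift ω) := ⟨sec g.1 b, sec_mem_G g.2 b⟩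

theorem smul_cons (g : G ω) (b : Bool) (y : V) :
    g • V.cons b y = V.cons (rootMap g.1 b) (secG g b • y) := by
  have hpref (n : ℕ) : pref (V.cons b y).1 (n + 1) = b :: pref y.1 n := pref_succ _ _
  refine Subtype.ext <| funext fun n => ?_
  change (g.1 • (V.cons b y).1) n = _
  rw [smul_apply, hpref, apply_cons_sec]
  cases n <;> rfl

theorem secG_mem_stabilizer {g : G ω} {S : Set V} (hg : g ∈ stabilizer (G ω) S) {b : Bool}
    (hb : rootMap g.1 b = b) : secG g b ∈ stabilizer (G (shift ω)) (V.cons b ⁻¹' S) := by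
  rw [mem_stabilizer_set] at hg ⊢
  intro y
  rw [Set.mem_preimage, Set.mem_preimage, ← hg (V.cons b y), smul_cons, hb]

theorem secG_true_mem_stabilizer_lastOneEven {g : G ω} (hg : g ∈ stabilizer (G ω) lastOneEven)
    (hroot : rootMap g.1 true = true) :
    secG g true ∈ stabilizer (G (shift ω)) lastOneEven := by
  rw [← stabilizer_compl, ← preimage_cons_true_lastOneEven]
  exact secG_mem_stabilizer hg hroot

theorem secG_false_mem_stabilizer_ΓPlus {g : G ω} (hg : g ∈ stabilizer (G ω) lastOneEven)
    (hroot : rootMap g.1 false = false) :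
    secG g false ∈ stabilizer (G (shift ω)) ΓPlus := by
  rw [← stabilizer_compl, ← preimage_cons_false_lastOneEven]
  exact secG_mem_stabilizer hg hroot

theorem secG_mem_stabilizer_lastOneEven {g : G ω} (hg : g ∈ stabilizer (G ω) ΓPlus) {b : Bool}
    (hroot : rootMap g.1 b = b) : secG g b ∈ stabilizer (G (shift ω)) lastOneEven := by
  rw [← stabilizer_compl, ← preimage_cons_ΓPlus b]
  exact secG_mem_stabilizer hg hroot

theorem aAut_mem_stabilizer_ΓPlus :
    (⟨aAut, aAut_mem_G⟩ : G ω) ∈ stabilizer (G ω) ΓPlus := by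
  rw [mem_stabilizer_set, ΓPlus_eq_insert]
  intro x
  have hsmul : (⟨aAut, aAut_mem_G⟩ : G ω) • x = V.flip 0 x := Subtype.ext (aAut_smul x.1)
  rw [hsmul, V.flip_zero_mem_iff]

theorem genAut_mem_stabilizer_lastOneEven (i : Fin 3) :
    (⟨genAut i ω, genAut_mem_G i⟩ : G ω) ∈ stabilizer (G ω) lastOneEven := by
  rw [mem_stabilizer_set]
  intro x
  obtain ⟨k, hk⟩ := exists_firstZero x.2
  have hsmul : (⟨genAut i ω, genAut_mem_G i⟩ : G ω) • x = if ω k = i then x else V.flip (k + 1) x :=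
    Subtype.ext <| (genAut_smul i ω hk).trans (apply_ite Subtype.val _ x (V.flip (k + 1) x)).symm
  rw [hsmul]
  split_ifs
  exacts [Iff.rfl, V.flip_succ_mem_iff hk]

end Stabilizers

/-! ### The flow through the cut at `Γ₊` -/

section Flow

variable {H α : Type*} [Group H] [MulAction H α]

theorem finite_support_indicator_smul_sub {S : Set α} {h : H}
    (hS : {x | ¬ (h • x ∈ S ↔ x ∈ S)}.Finite) :
    (Function.support fun x => S.indicator (1 : α → ℤ) (h • x) - S.indicator 1 x).Finite := by
  refine hS.subset fun x hx hiff => hx ?_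
  classical simp only [Set.indicator_apply, hiff, Pi.one_apply, sub_self]

/-- The flow of a commensurated set `S`: the number of points that are moved into `S` minus the
number of points that are moved out of `S`. -/
noncomputable def flow (S : Set α) (hS : ∀ h : H, {x | ¬ (h • x ∈ S ↔ x ∈ S)}.Finite) :
    H →* Multiplicative ℤ where
  toFun h := .ofAdd (∑ᶠ x, (S.indicator 1 (h • x) - S.indicator 1 x))
  map_one' := by simp
  map_mul' g h := by
    rw [← ofAdd_add, ← finsum_comp_equiv (MulAction.toPerm h)
      (f := fun x => S.indicator (1 : α → ℤ) (g • x) - S.indicator 1 x), ← finsum_add_distrib]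
    · simp only [mul_smul, MulAction.toPerm_apply, sub_add_sub_cancel]
    · exact (finite_support_indicator_smul_sub (hS g)).preimage (MulAction.injective h).injOn
    · exact finite_support_indicator_smul_sub (hS h)

theorem flow_insert {S : Set α} {x₀ : α} (hx₀ : x₀ ∉ S)
    (hS : ∀ h : H, {x | ¬ (h • x ∈ insert x₀ S ↔ x ∈ insert x₀ S)}.Finite) {h : H}
    (hh : ∀ x, h • x ∈ S ↔ x ∈ insert x₀ S) : flow (insert x₀ S) hS h = .ofAdd 1 := by
  classical
  have hval (x : α) : (insert x₀ S).indicator (1 : α → ℤ) (h • x) - (insert x₀ S).indicator 1 x =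
      ({h⁻¹ • x₀} : Set α).indicator 1 x := by
    simp only [Set.indicator_apply, ← hh x, Set.mem_singleton_iff, eq_inv_smul_iff, Pi.one_apply]
    by_cases hx : h • x = x₀
    · simp [hx, hx₀]
    · simp [hx]
  refine congrArg Multiplicative.ofAdd ?_
  rw [finsum_congr hval, ← finsum_mem_def, finsum_mem_singleton, Pi.one_apply]

end Flow

section FixedLevel

variable {ω : ℕ → Fin 3}

theorem monoidHom_eq_one {M : Type*} [Group M] [IsMulTorsionFree M] (f : G ω →* M) : f = 1 := by
  have hinvol {s : G ω} (hs : s * s = 1) : f s = 1 :=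
    (pow_eq_one_iff_left two_ne_zero).1 (by rw [sq, ← f.map_mul, hs, f.map_one])
  refine MonoidHom.ext fun ⟨g, hg⟩ => ?_
  induction hg using G_induction with
  | one => exact f.map_one
  | a => exact hinvol (Subtype.ext aAut_mul_self)
  | gen i => exact hinvol (Subtype.ext (genAut_mul_self i))
  | mul g h hg hh ihg ihh =>
    exact (f.map_mul ⟨g, hg⟩ ⟨h, hh⟩).trans ((congrArg₂ (· * ·) ihg ihh).trans (one_mul 1))

open scoped Pointwise in
/- Otherwise the section at `0` maps `Γ₊` onto `Γ₊ ∖ {0^∞}`, so its flow is `1`. -/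
theorem rootMap_eq_self {g : G ω} (hg : g ∈ MulAction.stabilizer (G ω) lastOneEven) (b : Bool) :
    rootMap g.1 b = b := by
  rw [rootMap_eq_xor]
  rcases hroot : rootMap g.1 false
  · exact Bool.xor_false b
  have hsec (y : V) : secG g false • y ∈ lastOneEven ↔ y ∈ insert zeroSeq lastOneEven := by
    have h := MulAction.mem_stabilizer_set.1 hg (V.cons false y)
    rwa [smul_cons, hroot, V.cons_true_mem_lastOneEven, V.cons_false_mem_lastOneEven,
      not_iff_not] at h
  have hflow := flow_insert zeroSeq_notMem_lastOneEven (ΓPlus_eq_insert ▸ commensurate) hsec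
  rw [monoidHom_eq_one (flow _ _)] at hflow
  exact absurd (congrArg Multiplicative.toAdd hflow) zero_ne_one

end FixedLevel

/-! ### Signs and the dihedral quotient -/

section Signs

theorem rootMap_not (g : TreeAut) (b : Bool) : rootMap g (!b) = !rootMap g b := by
  rw [rootMap_eq_xor, rootMap_eq_xor g b, Bool.not_xor]

/-- The sign of the permutation of the first level. -/
def rootSign : TreeAut →* ℤˣ where
  toFun g := if rootMap g false then -1 else 1
  map_one' := rfl
  map_mul' g h := by
    rw [rootMap_mul, rootMap_eq_xor g (rootMap h false)]
    cases rootMap h false <;> cases rootMap g false <;> rfl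

/-- The product of the values of `χ` at the two sections. -/
def secProd (χ : TreeAut →* ℤˣ) : TreeAut →* ℤˣ where
  toFun g := χ (sec g false) * χ (sec g true)
  map_one' := by rw [sec_one, sec_one, map_one, one_mul]
  map_mul' g h := by
    rw [sec_mul, sec_mul, ← Bool.not_false, rootMap_not, Bool.not_false, map_mul, map_mul]
    cases rootMap h false
    · exact mul_mul_mul_comm _ _ _ _
    · rw [mul_mul_mul_comm, mul_comm (χ (sec g true)), Bool.not_true]

/-- The sign of the portrait of level `n`: each vertex of that level at which the two children are
exchanged contributes a factor `-1`. -/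
def levelSign : ℕ → TreeAut →* ℤˣ
  | 0 => rootSign
  | n + 1 => secProd (levelSign n)

theorem secProd_aAut (χ : TreeAut →* ℤˣ) : secProd χ aAut = 1 := (secProd χ).map_one

theorem rootSign_genAut (i : Fin 3) (ω : ℕ → Fin 3) : rootSign (genAut i ω) = 1 := by
  change (if rootMap (genAut i ω) false then (-1 : ℤˣ) else 1) = 1
  rw [rootMap_genAut, if_neg Bool.false_ne_true]

theorem secProd_genAut (χ : TreeAut →* ℤˣ) (i : Fin 3) (ω : ℕ → Fin 3) :
    secProd χ (genAut i ω) = (if ω 0 = i then 1 else χ aAut) * χ (genAut i (shift ω)) := by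
  change χ (sec _ _) * χ (sec _ _) = _
  rw [sec_genAut_true, sec_genAut_false, apply_ite χ, map_one]

theorem levelSign_succ_genAut (n : ℕ) (i : Fin 3) (ω : ℕ → Fin 3) :
    levelSign (n + 1) (genAut i ω) = if ω n = i then 1 else -1 := by
  induction n generalizing ω with
  | zero =>
    rw [levelSign, secProd_genAut, levelSign, rootSign_genAut, mul_one]
    rfl
  | succ n ih =>
    rw [levelSign, secProd_genAut, ih, levelSign, secProd_aAut, ite_self, one_mul]
    rfl

/-- A character of the automorphism group that is trivial on `a` and, among `b_ω`, `c_ω`, `d_ω`,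
exactly on the generator with index `i`. -/
structure IsParity (ω : ℕ → Fin 3) (i : Fin 3) (χ : TreeAut →* ℤˣ) : Prop where
  map_aAut : χ aAut = 1
  map_genAut : ∀ j, χ (genAut j ω) = if i = j then 1 else -1

theorem exists_isParity {ω : ℕ → Fin 3} (hω : ω 0 ≠ ω 1) (i : Fin 3) : ∃ χ, IsParity ω i χ := by
  by_cases h : i = ω 0 ∨ i = ω 1
  · obtain ⟨n, rfl⟩ : ∃ n, i = ω n := h.elim (⟨0, ·⟩) (⟨1, ·⟩)
    exact ⟨levelSign (n + 1), secProd_aAut _, fun j => levelSign_succ_genAut n j ω⟩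
  · refine ⟨levelSign 1 * levelSign 2, (congrArg₂ (· * ·) (secProd_aAut _) (secProd_aAut _)), ?_⟩
    intro j
    rw [MonoidHom.mul_apply, levelSign_succ_genAut, levelSign_succ_genAut]
    generalize ω 0 = k at *
    generalize ω 1 = l at *
    decide +revert

open DihedralGroup

/-- The homomorphism that takes `-1` to the reflection `sr k`. -/
def reflectionHom (k : ZMod 4) : ℤˣ →* DihedralGroup 4 where
  toFun u := if u = 1 then 1 else sr k
  map_one' := rfl
  map_mul' := by decide +revert

/-- The signed permutation matrix of size two with entries given by the action of `g` on the first
level and by the values of `χ` at the sections, in the group of symmetries of the square. The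
diagonal matrices are generated by `sr 0` and `sr 2`, and `sr 1` is the permutation matrix. -/
def monomial (χ : TreeAut →* ℤˣ) : TreeAut →* DihedralGroup 4 where
  toFun g := reflectionHom 1 (rootSign g) *
    (reflectionHom 0 (χ (sec g false)) * reflectionHom 2 (χ (sec g true)))
  map_one' := by simp only [sec_one, map_one, mul_one]
  map_mul' g h := by
    have hmatrix : ∀ (p : Bool) (r u v : ℤˣ) (x : Bool → ℤˣ),
        reflectionHom 1 (r * if p then -1 else 1) *
          (reflectionHom 0 (x p * u) * reflectionHom 2 (x (!p) * v)) =
        reflectionHom 1 r * (reflectionHom 0 (x false) * reflectionHom 2 (x true)) *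
          (reflectionHom 1 (if p then -1 else 1) * (reflectionHom 0 u * reflectionHom 2 v)) := by
      decide
    rw [map_mul rootSign, sec_mul, sec_mul, ← Bool.not_false, rootMap_not, map_mul χ, map_mul χ]
    exact hmatrix (rootMap h false) _ _ _ fun b => χ (sec g b)

/-- The automorphism of the symmetry group of the square that exchanges the two classes of
reflections. -/
def reflectionSwap : DihedralGroup 4 →* DihedralGroup 4 where
  toFun
    | r i => r (-i)
    | sr i => sr (3 - i)
  map_one' := rfl
  map_mul' := by rintro (i | i) (j | j) <;> simp <;> ring

theorem monomial_aAut (χ : TreeAut →* ℤˣ) : monomial χ aAut = sr 1 := by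
  change reflectionHom 1 (-1) * (reflectionHom 0 (χ 1) * reflectionHom 2 (χ 1)) = _
  rw [map_one, map_one, map_one]
  rfl

theorem IsParity.monomial_genAut {ω : ℕ → Fin 3} {i : Fin 3} {χ : TreeAut →* ℤˣ}
    (hχ : IsParity (shift ω) i χ) (j : Fin 3) :
    monomial χ (genAut j ω) = if i = j then 1 else sr 2 := by
  have hfalse : χ (if ω 0 = j then 1 else aAut) = 1 := by
    rw [apply_ite χ, map_one, hχ.map_aAut, ite_self]
  change reflectionHom 1 (rootSign _) * (reflectionHom 0 (χ (sec _ _)) *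
    reflectionHom 2 (χ (sec _ _))) = _
  rw [rootSign_genAut, sec_genAut_false, hfalse, sec_genAut_true, hχ.map_genAut, map_one, map_one,
    one_mul, one_mul]
  split_ifs <;> rfl

theorem IsParity.monomial_sec {ω : ℕ → Fin 3} {χ : TreeAut →* ℤˣ}
    (hχ : IsParity (shift (shift ω)) (ω 0) χ) {g : TreeAut} (hg : g ∈ G ω) (b : Bool) :
    monomial χ (sec g b) = reflectionSwap (monomial χ (sec g !b)) := by
  induction hg using G_induction generalizing b with
  | one => simp only [sec_one, map_one]
  | a => simp only [sec_aAut, map_one]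
  | gen i =>
    cases b <;> simp only [Bool.not_false, Bool.not_true, sec_genAut_true, sec_genAut_false,
      hχ.monomial_genAut] <;> split_ifs <;>
      simp only [map_one, monomial_aAut] <;> rfl
  | mul g h _ _ ihg ihh =>
    rw [sec_mul, sec_mul, map_mul, map_mul, map_mul, rootMap_not, ← ihg, ← ihh]

end Signs

/-! ### Stabilizers of half-lines -/

section HalfLines

variable {ω : ℕ → Fin 3}

theorem genFun_comp {i j k : Fin 3} (hij : i ≠ j) (hik : i ≠ k) (hjk : j ≠ k) (ω : ℕ → Fin 3)
    (w : List Bool) : genFun i ω (genFun j ω w) = genFun k ω w := by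
  induction w generalizing ω with
  | nil => simp [genFun]
  | cons b w ih =>
    cases b with
    | true => simp [genFun, ih]
    | false =>
      obtain h | h | h : ω 0 = i ∨ ω 0 = j ∨ ω 0 = k := by omega
      · simp [genFun, h, hij, hik]
      · simp [genFun, h, hij.symm, hjk]
      · simp [genFun, h, hik.symm, hjk.symm, aFun_aFun]

/-- The Klein four-group `{1, b_ω, c_ω, d_ω}`. -/
def kleinFour (ω : ℕ → Fin 3) : Subgroup TreeAut where
  carrier := insert 1 (Set.range (genAut · ω))
  one_mem' := Set.mem_insert _ _
  mul_mem' := by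
    rintro g h (rfl | ⟨i, rfl⟩) (rfl | ⟨j, rfl⟩)
    · exact Or.inl (one_mul 1)
    · exact Or.inr ⟨j, (one_mul _).symm⟩
    · exact Or.inr ⟨i, (mul_one _).symm⟩
    · rcases eq_or_ne i j with rfl | hij
      · exact Or.inl (genAut_mul_self i)
      · obtain ⟨k, hik, hjk⟩ : ∃ k : Fin 3, i ≠ k ∧ j ≠ k := by decide +revert
        exact Or.inr ⟨k, Subtype.ext (Equiv.ext fun w => (genFun_comp hij hik hjk ω w).symm)⟩
  inv_mem' := by
    rintro g (rfl | ⟨i, rfl⟩)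
    · exact Or.inl inv_one
    · exact Or.inr ⟨i, (inv_eq_of_mul_eq_one_left (genAut_mul_self i)).symm⟩

theorem genAut_mem_kleinFour (i : Fin 3) : genAut i ω ∈ kleinFour ω := Or.inr ⟨i, rfl⟩

theorem finite_kleinFour (ω : ℕ → Fin 3) : (kleinFour ω : Set TreeAut).Finite :=
  (Set.finite_range _).insert 1

theorem kleinFour_le_G : kleinFour ω ≤ G ω := by
  rintro g (rfl | ⟨i, rfl⟩)
  exacts [one_mem _, genAut_mem_G i]

theorem rootMap_of_mem_kleinFour {g : TreeAut} (hg : g ∈ kleinFour ω) (b : Bool) :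
    rootMap g b = b := by
  rcases hg with rfl | ⟨i, rfl⟩
  exacts [rfl, rootMap_genAut i ω b]

theorem sec_true_mem_kleinFour {g : TreeAut} (hg : g ∈ kleinFour ω) :
    sec g true ∈ kleinFour (shift ω) := by
  rcases hg with rfl | ⟨i, rfl⟩
  exacts [one_mem _, genAut_mem_kleinFour i]

theorem sec_false_of_mem_kleinFour {g : TreeAut} (hg : g ∈ kleinFour ω) :
    sec g false = 1 ∨ sec g false = aAut := by
  rcases hg with rfl | ⟨i, rfl⟩
  · exact Or.inl rfl
  · rw [sec_genAut_false]
    exact ite_eq_or_eq _ _ _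

/-- The dihedral group of order eight generated by `a` and by the generator with index `ω 0`, which
fixes `0^∞`. It is described by the sections of its elements. -/
def dihedral (ω : ℕ → Fin 3) : Set TreeAut :=
  {g | ∀ b, sec g b = 1 ∨ sec g b = genAut (ω 0) (shift ω)}

theorem finite_dihedral (ω : ℕ → Fin 3) : (dihedral ω).Finite := by
  refine Set.Finite.of_injOn (f := fun g => (rootMap g, sec g))
    (t := Set.univ ×ˢ Set.univ.pi fun _ => {1, genAut (ω 0) (shift ω)})
    (fun g hg => ⟨trivial, fun b _ => hg b⟩)
    (fun g _ h _ hgh => treeAut_ext (congrFun (Prod.ext_iff.1 hgh).1)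
      (congrFun (Prod.ext_iff.1 hgh).2))
    (Set.finite_univ.prod (Set.Finite.pi fun _ => Set.toFinite _))

theorem one_or_aAut_mem_dihedral {g : TreeAut} (hg : g = 1 ∨ g = aAut) : g ∈ dihedral ω := by
  rcases hg with rfl | rfl <;> exact fun b => Or.inl rfl

theorem mem_dihedral_of_sec_mem_kleinFour (hω : ω 2 ≠ ω 3) {g : TreeAut} (hg : g ∈ G ω)
    (hsec : ∀ b, sec g b ∈ kleinFour (shift ω)) : g ∈ dihedral ω := by
  obtain ⟨χ, hχ⟩ := exists_isParity (ω := shift (shift ω)) hω (ω 0)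
  intro b
  have hswap := hχ.monomial_sec hg b
  rcases hsec b with hb | ⟨j, hb⟩
  · exact Or.inl hb
  refine Or.inr ?_
  simp only [← hb, hχ.monomial_genAut] at hswap ⊢
  rcases eq_or_ne (ω 0) j with hj | hj
  · rw [hj]
  rw [if_neg hj] at hswap
  rcases hsec !b with hb' | ⟨k, hb'⟩
  · rw [hb', map_one, map_one] at hswap
    exact absurd hswap (by decide)
  · simp only [← hb', hχ.monomial_genAut] at hswap
    split_ifs at hswap <;> exact absurd hswap (by decide)

theorem rootMap_false_eq_of_rootSign_eq {g h : TreeAut} (hgh : rootSign g = rootSign h) :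
    rootMap g false = rootMap h false := by
  change (if rootMap g false then (-1 : ℤˣ) else 1) = if rootMap h false then -1 else 1 at hgh
  revert hgh
  cases rootMap g false <;> cases rootMap h false <;> decide

theorem IsParity.eq_of_monomial_eq {i : Fin 3} {χ : TreeAut →* ℤˣ}
    (hχ : IsParity (shift ω) i χ) (hi : i ≠ ω 0) {g h : TreeAut} (hg : g ∈ dihedral ω)
    (hh : h ∈ dihedral ω) (heq : monomial χ g = monomial χ h) : g = h := by
  have hinj : ∀ r u v r' u' v' : ℤˣ,
      reflectionHom 1 r * (reflectionHom 0 u * reflectionHom 2 v) =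
        reflectionHom 1 r' * (reflectionHom 0 u' * reflectionHom 2 v') →
      r = r' ∧ u = u' ∧ v = v' := by decide
  obtain ⟨hroot, hfalse, htrue⟩ := hinj _ _ _ _ _ _ heq
  have hsec {k : TreeAut} (hk : k ∈ dihedral ω) (b : Bool) :
      sec k b = if χ (sec k b) = 1 then 1 else genAut (ω 0) (shift ω) := by
    rcases hk b with hb | hb <;> rw [hb]
    · rw [map_one, if_pos rfl]
    · rw [hχ.map_genAut, if_neg hi, if_neg (by decide)]
  refine treeAut_ext (fun b => ?_) ?_
  · rw [rootMap_eq_xor, rootMap_eq_xor h, rootMap_false_eq_of_rootSign_eq hroot]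
  · rintro (_ | _)
    · rw [hsec hg, hsec hh, hfalse]
    · rw [hsec hg, hsec hh, htrue]

theorem mem_kleinFour_of_sec_mem (hω : ω 0 ≠ ω 1) (hω' : ω 2 ≠ ω 3) {g : TreeAut} (hg : g ∈ G ω)
    (hroot : ∀ b, rootMap g b = b) (hfalse : sec g false ∈ dihedral (shift ω))
    (htrue : sec g true ∈ kleinFour (shift ω)) : g ∈ kleinFour ω := by
  obtain ⟨χ, hχ⟩ := exists_isParity (ω := shift (shift ω)) hω' (ω 0)
  obtain ⟨s, hs, hgs⟩ : ∃ s ∈ kleinFour ω, sec g true = sec s true := by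
    rcases htrue with h | ⟨j, h⟩
    exacts [⟨1, one_mem _, h⟩, ⟨genAut j ω, genAut_mem_kleinFour j, h.symm⟩]
  have hsec : sec g false = sec s false := by
    refine hχ.eq_of_monomial_eq hω hfalse
      (one_or_aAut_mem_dihedral (sec_false_of_mem_kleinFour hs)) ?_
    rw [hχ.monomial_sec hg, hχ.monomial_sec (kleinFour_le_G hs), Bool.not_false, hgs]
  have hgs' : g = s := by
    refine treeAut_ext (fun b => (hroot b).trans (rootMap_of_mem_kleinFour hs b).symm) ?_
    rintro (_ | _)
    exacts [hsec, hgs]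
  exact hgs' ▸ hs

end HalfLines

section Words

open scoped Pointwise

variable {ω : ℕ → Fin 3} {m n : ℕ}

/-- The products of elements of the Klein four-group and of at most `n` factors `a`. -/
def words (ω : ℕ → Fin 3) (n : ℕ) : Set TreeAut :=
  (kleinFour ω : Set TreeAut) * ({1, aAut} * (kleinFour ω : Set TreeAut)) ^ n

theorem words_zero : words ω 0 = kleinFour ω := by rw [words, pow_zero, mul_one]

theorem words_mono : Monotone (words ω) := fun _ _ hmn =>
  Set.mul_subset_mul_left <| Set.pow_subset_pow_right
    ⟨1, Set.mem_insert _ _, 1, one_mem (kleinFour ω), mul_one (1 : TreeAut)⟩ hmn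

theorem words_mul_kleinFour : words ω n * (kleinFour ω : Set TreeAut) = words ω n := by
  rw [words, ← mul_pow_mul, mul_assoc, coe_mul_coe]

theorem kleinFour_mul_words : (kleinFour ω : Set TreeAut) * words ω n = words ω n := by
  rw [words, ← mul_assoc, coe_mul_coe]

theorem words_mul_words : words ω m * words ω n = words ω (m + n) := by
  rw [words.eq_1 ω n, ← mul_assoc, words_mul_kleinFour, words, words, mul_assoc, ← pow_add]

theorem mem_words_succ {g : TreeAut} : g ∈ words ω (n + 1) ↔
    g ∈ words ω n ∨ ∃ h ∈ words ω n, ∃ s ∈ kleinFour ω, g = h * aAut * s := by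
  rw [words, pow_succ, ← mul_assoc, ← words, ← mul_assoc]
  constructor
  · rintro ⟨_, ⟨h, hh, c, rfl | rfl, rfl⟩, s, hs, rfl⟩
    · exact Or.inl (words_mul_kleinFour ▸ Set.mul_mem_mul ((mul_one h).symm ▸ hh) hs)
    · exact Or.inr ⟨h, hh, s, hs, rfl⟩
  · rintro (hg | ⟨h, hh, s, hs, rfl⟩)
    · exact ⟨g * 1, ⟨g, hg, 1, Or.inl rfl, rfl⟩, 1, one_mem (kleinFour ω), by simp only [mul_one]⟩
    · exact ⟨h * aAut, ⟨h, hh, aAut, Or.inr rfl, rfl⟩, s, hs, rfl⟩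

theorem aAut_mem_words_one : aAut ∈ words ω 1 :=
  mem_words_succ.2 <| Or.inr
    ⟨1, words_zero.symm ▸ one_mem (kleinFour ω), 1, one_mem _, by rw [one_mul, mul_one]⟩

theorem exists_mem_words {g : TreeAut} (hg : g ∈ G ω) : ∃ n, g ∈ words ω n := by
  induction hg using G_induction with
  | one => exact ⟨0, words_zero.symm ▸ one_mem (kleinFour ω)⟩
  | a => exact ⟨1, aAut_mem_words_one⟩
  | gen i => exact ⟨0, words_zero.symm ▸ genAut_mem_kleinFour i⟩
  | mul g h _ _ ihg ihh =>
    obtain ⟨m, hm⟩ := ihg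
    obtain ⟨n, hn⟩ := ihh
    exact ⟨m + n, words_mul_words ▸ Set.mul_mem_mul hm hn⟩

theorem sec_false_mem_words_one {s : TreeAut} (hs : s ∈ kleinFour ω) :
    sec s false ∈ words (shift ω) 1 := by
  rcases sec_false_of_mem_kleinFour hs with h | h <;> rw [h]
  exacts [words_mono zero_le_one (words_zero.symm ▸ one_mem (kleinFour _)), aAut_mem_words_one]

theorem sec_mem_words {g : TreeAut} (hg : g ∈ words ω n) :
    sec g true ∈ words (shift ω) ((n + 1) / 2) ∧ sec g false ∈ words (shift ω) ((n + 2) / 2) := by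
  induction n generalizing g with
  | zero =>
    rw [words_zero] at hg
    exact ⟨words_zero.symm ▸ sec_true_mem_kleinFour hg, sec_false_mem_words_one hg⟩
  | succ n ih =>
    rcases mem_words_succ.1 hg with hg | ⟨h, hh, s, hs, rfl⟩
    · exact ⟨words_mono (by lia) (ih hg).1, words_mono (by lia) (ih hg).2⟩
    · have hsec (b : Bool) : sec (h * aAut * s) b = sec h (!b) * sec s b := by
        rw [sec_mul, sec_mul, rootMap_of_mem_kleinFour hs, sec_aAut, mul_one, rootMap_aAut]
      have hfalse := words_mul_words ▸ Set.mul_mem_mul (ih hh).1 (sec_false_mem_words_one hs)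
      rw [hsec, hsec]
      exact ⟨words_mul_kleinFour ▸ Set.mul_mem_mul (ih hh).2 (sec_true_mem_kleinFour hs),
        words_mono (by lia) hfalse⟩

theorem mem_words_add_two {g : TreeAut} (hg : g ∈ words ω (n + 2)) :
    g ∈ words ω (n + 1) ∨ ∃ s ∈ kleinFour ω, ∃ h ∈ words ω n, ∃ t ∈ kleinFour ω,
      g = s * (aAut * h * aAut) * t := by
  rw [show n + 2 = 1 + (n + 1) by lia, ← words_mul_words] at hg
  obtain ⟨p, hp, q, hq, rfl⟩ := hg
  rcases mem_words_succ.1 hp with hp' | ⟨s, hs, s', hs', rfl⟩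
  · rw [words_zero] at hp'
    exact Or.inl (kleinFour_mul_words ▸ Set.mul_mem_mul hp' hq)
  rcases mem_words_succ.1 hq with hq' | ⟨h, hh, t, ht, rfl⟩
  · exact Or.inl (add_comm 1 n ▸ words_mul_words ▸ Set.mul_mem_mul hp hq')
  · rw [words_zero] at hs
    exact Or.inr ⟨s, hs, s' * h, kleinFour_mul_words ▸ Set.mul_mem_mul hs' hh, t, ht,
      by simp only [mul_assoc]⟩

end Words

section Contraction

open MulAction
open scoped Pointwise

variable {ω : ℕ → Fin 3} {n : ℕ}

theorem mem_stabilizer_lastOneEven_of_mem_kleinFour {g : TreeAut} (hg : g ∈ kleinFour ω) :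
    (⟨g, kleinFour_le_G hg⟩ : G ω) ∈ stabilizer (G ω) lastOneEven := by
  rcases hg with rfl | ⟨i, rfl⟩
  exacts [one_mem _, genAut_mem_stabilizer_lastOneEven i]

theorem sec_mem_words_div_two {g : TreeAut} (hg : g ∈ words ω n) (b : Bool) :
    sec g b ∈ words (shift ω) (n / 2 + 1) := by
  cases b
  exacts [words_mono (by lia) (sec_mem_words hg).2, words_mono (by lia) (sec_mem_words hg).1]

theorem mem_dihedral_of_mem_words (hω : ω 2 ≠ ω 3)
    (ih : ∀ h ∈ stabilizer (G (shift ω)) lastOneEven, h.1 ∈ words (shift ω) (n / 2 + 1) →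
      h.1 ∈ kleinFour (shift ω))
    {g : G ω} (hg : g ∈ stabilizer (G ω) ΓPlus) (hw : g.1 ∈ words ω n) : g.1 ∈ dihedral ω := by
  refine mem_dihedral_of_sec_mem_kleinFour hω g.2 fun b => ?_
  cases hroot : rootMap g.1 false
  · have hb : rootMap g.1 b = b := by rw [rootMap_eq_xor, hroot, Bool.xor_false]
    exact ih (secG g b) (secG_mem_stabilizer_lastOneEven hg hb) (sec_mem_words_div_two hw b)
  · let a : G ω := ⟨aAut, aAut_mem_G⟩
    have hga : g * a ∈ stabilizer (G ω) ΓPlus := mul_mem hg aAut_mem_stabilizer_ΓPlus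
    have hb : rootMap (g * a).1 (!b) = !b := by
      rw [Subgroup.coe_mul, rootMap_mul, rootMap_aAut, rootMap_eq_xor, hroot, Bool.not_not,
        Bool.xor_true]
    have hsec : sec (g * a).1 (!b) = sec g.1 b := by
      rw [Subgroup.coe_mul, sec_mul, rootMap_aAut, sec_aAut, mul_one, Bool.not_not]
    have hmem := ih (secG (g * a) !b) (secG_mem_stabilizer_lastOneEven hga hb)
    simp only [secG, hsec] at hmem
    exact hmem (sec_mem_words_div_two hw b)

theorem mem_kleinFour_of_conj_aAut_mem_words (hω : ∀ i, ω i ≠ ω (i + 1))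
    (ih : ∀ m < n + 2, ∀ {ω : ℕ → Fin 3}, (∀ i, ω i ≠ ω (i + 1)) → ∀ {g : G ω},
      g ∈ stabilizer (G ω) lastOneEven → g.1 ∈ words ω m → g.1 ∈ kleinFour ω)
    {g : G ω} (hg : g ∈ stabilizer (G ω) lastOneEven) {h : TreeAut} (hh : h ∈ words ω n)
    (hgh : g.1 = aAut * h * aAut) : g.1 ∈ kleinFour ω := by
  have hsec (b : Bool) : sec g.1 b = sec h !b := by
    rw [hgh, sec_mul, sec_mul, sec_aAut, sec_aAut, one_mul, mul_one, rootMap_aAut]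
  have hroot := rootMap_eq_self hg
  refine mem_kleinFour_of_sec_mem (hω 0) (hω 2) g.2 hroot
    (mem_dihedral_of_mem_words (n := (n + 1) / 2) (g := secG g false) (hω 3) ?_
      (secG_false_mem_stabilizer_ΓPlus hg (hroot false)) ?_)
    (ih (n / 2 + 1) (by lia) (fun i => hω (i + 1))
      (secG_true_mem_stabilizer_lastOneEven hg (hroot true)) ?_)
  · exact fun k hk hw => ih _ (by lia) (fun i => hω (i + 2)) hk hw
  · change sec g.1 false ∈ _
    rw [hsec]
    exact (sec_mem_words hh).1
  · change sec g.1 true ∈ _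
    rw [hsec]
    exact sec_mem_words_div_two hh false

theorem mem_kleinFour_of_mem_words (hω : ∀ i, ω i ≠ ω (i + 1)) {g : G ω}
    (hg : g ∈ stabilizer (G ω) lastOneEven) (hw : g.1 ∈ words ω n) : g.1 ∈ kleinFour ω := by
  induction n using Nat.strong_induction_on generalizing ω with
  | _ n ih =>
    match n with
    | 0 => rwa [words_zero] at hw
    | 1 =>
      rcases mem_words_succ.1 hw with hw | ⟨s, hs, t, ht, hst⟩
      · rwa [words_zero] at hw
      · rw [words_zero] at hs
        have hroot := rootMap_eq_self hg false
        rw [hst, rootMap_mul, rootMap_mul, rootMap_of_mem_kleinFour ht,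
          rootMap_of_mem_kleinFour hs] at hroot
        exact absurd hroot (by decide)
    | n + 2 =>
      rcases mem_words_add_two hw with hw | ⟨s, hs, h, hh, t, ht, hst⟩
      · exact ih (n + 1) (by lia) hω hg hw
      let s' : G ω := ⟨s, kleinFour_le_G hs⟩
      let t' : G ω := ⟨t, kleinFour_le_G ht⟩
      have hmid : s'⁻¹ * g * t'⁻¹ ∈ stabilizer (G ω) lastOneEven :=
        mul_mem (mul_mem (inv_mem (mem_stabilizer_lastOneEven_of_mem_kleinFour hs)) hg)
          (inv_mem (mem_stabilizer_lastOneEven_of_mem_kleinFour ht))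
      have hmid_eq : s⁻¹ * g.1 * t⁻¹ = aAut * h * aAut := by
        rw [hst]
        group
      have hmem := mem_kleinFour_of_conj_aAut_mem_words hω ih hmid hh hmid_eq
      rw [hst]
      exact mul_mem (mul_mem hs (hmid_eq ▸ hmem)) ht

theorem finite_stabilizer_lastOneEven (hω : ∀ i, ω i ≠ ω (i + 1)) :
    (stabilizer (G ω) lastOneEven : Set (G ω)).Finite := by
  refine ((finite_kleinFour ω).preimage Subtype.val_injective.injOn).subset fun g hg => ?_
  obtain ⟨n, hn⟩ := exists_mem_words g.2
  exact mem_kleinFour_of_mem_words hω hg hn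

theorem finite_stabilizer_ΓPlus (hω : ∀ i, ω i ≠ ω (i + 1)) :
    (stabilizer (G ω) ΓPlus : Set (G ω)).Finite := by
  refine ((finite_dihedral ω).preimage Subtype.val_injective.injOn).subset fun g hg => ?_
  obtain ⟨n, hn⟩ := exists_mem_words g.2
  exact mem_dihedral_of_mem_words (hω 2)
    (fun _ hh hw => mem_kleinFour_of_mem_words (fun i => hω (i + 1)) hh hw) hg hn

end Contraction

section FiniteStabilizers

open MulAction
open scoped Pointwise

variable {ω : ℕ → Fin 3} {S : Set V}

theorem finite_stabilizer_of_preimage_cons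
    (hS : ∀ b, (stabilizer (G (shift ω)) (V.cons b ⁻¹' S) : Set (G (shift ω))).Finite) :
    (stabilizer (G ω) S : Set (G ω)).Finite := by
  let sign : stabilizer (G ω) S →* ℤˣ :=
    rootSign.comp ((G ω).subtype.comp (stabilizer (G ω) S).subtype)
  have hroot (g : sign.ker) (b : Bool) : rootMap g.1.1.1 b = b := by
    have hsign : rootSign g.1.1.1 = rootSign 1 := g.2
    rw [rootMap_eq_xor, rootMap_false_eq_of_rootSign_eq hsign]
    exact Bool.xor_false b
  refine Set.finite_coe_iff.1 (sign.finite_iff_finite_ker_range.2 ⟨?_, inferInstance⟩)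
  have (b : Bool) : Finite (stabilizer (G (shift ω)) (V.cons b ⁻¹' S)) := hS b
  refine Finite.of_injective
    (fun (g : sign.ker) b => (⟨secG g.1.1 b, secG_mem_stabilizer g.1.2 (hroot g b)⟩ :
      stabilizer (G (shift ω)) (V.cons b ⁻¹' S))) fun g h hgh => ?_
  refine Subtype.ext (Subtype.ext (Subtype.ext (treeAut_ext (fun b => ?_) fun b => ?_)))
  · rw [hroot, hroot]
  · exact congrArg (fun k => k.1.1) (congrFun hgh b)

theorem V.ne_zeroSeq {x : V} {k : ℕ} (hk : x.1 k = true) : x ≠ zeroSeq := by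
  rintro rfl
  exact Bool.false_ne_true hk

theorem finite_stabilizer_of_mem_iff (n : ℕ) (hω : ∀ i ≥ n, ω i ≠ ω (i + 1))
    (hS : ∀ x : V, ∀ k ≥ n, x.1 k = true → (x ∈ S ↔ x ∈ lastOneEven)) :
    (stabilizer (G ω) S : Set (G ω)).Finite := by
  induction n generalizing ω S with
  | zero =>
    have hmem {x : V} (hx : x ≠ zeroSeq) : x ∈ S ↔ x ∈ lastOneEven := by
      obtain ⟨k, hk, -⟩ := V.exists_isGreatest hx
      exact hS x k k.zero_le hk
    have hlast : S \ {zeroSeq} = lastOneEven := Set.ext fun x => by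
      rcases eq_or_ne x zeroSeq with rfl | hx
      · exact iff_of_false (fun h => h.2 rfl) zeroSeq_notMem_lastOneEven
      · rw [Set.mem_sdiff, Set.mem_singleton_iff, and_iff_left hx, hmem hx]
    by_cases hzero : zeroSeq ∈ S
    · have hΓ : ΓPlus = S := by
        rw [ΓPlus_eq_insert, ← hlast, Set.insert_sdiff_singleton, Set.insert_eq_of_mem hzero]
      exact hΓ ▸ finite_stabilizer_ΓPlus fun i => hω i i.zero_le
    · rw [Set.sdiff_singleton_eq_self hzero] at hlast
      exact hlast ▸ finite_stabilizer_lastOneEven fun i => hω i i.zero_le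
  | succ n ih =>
    refine finite_stabilizer_of_preimage_cons fun b => ?_
    rw [← stabilizer_compl]
    refine ih (fun i hi => hω (i + 1) (Nat.succ_le_succ hi)) fun y k hk hy => ?_
    rw [Set.mem_compl_iff, Set.mem_preimage, hS (V.cons b y) (k + 1) (Nat.succ_le_succ hk) hy,
      V.cons_mem_lastOneEven (V.ne_zeroSeq hy), not_not]

theorem finite_stabilizer (hω : ∀ᶠ i in Filter.atTop, ω i ≠ ω (i + 1)) (φ : X) :
    (stabilizer (G ω) φ : Set (G ω)).Finite := by
  obtain ⟨M, hM⟩ := Filter.eventually_atTop.1 hω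
  obtain ⟨N, hN⟩ := (φ.finite_ne_indicator.biUnion fun x _ => x.2).bddAbove
  have hmem (x : V) (k : ℕ) (hk : k ≥ max M (N + 1)) (hx : x.1 k = true) :
      x ∈ {x | 1 / 2 < φ.1 x} ↔ x ∈ lastOneEven := by
    have hφ : φ.1 x = ΓPlus.indicator 1 x := by
      by_contra hne
      exact (Nat.lt_of_succ_le (le_of_max_le_right hk)).not_ge (hN (Set.mem_biUnion hne hx))
    have hΓ : x ∈ ΓPlus ↔ x ∈ lastOneEven := by
      rw [ΓPlus_eq_insert, Set.mem_insert_iff, or_iff_right (V.ne_zeroSeq hx)]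
    rw [Set.mem_ofPred_eq, hφ, ← hΓ]
    by_cases h : x ∈ ΓPlus <;> norm_num [h]
  refine (finite_stabilizer_of_mem_iff (max M (N + 1))
    (fun i hi => hM i (le_of_max_le_left hi)) hmem).subset fun g hg => ?_
  refine mem_stabilizer_set.2 fun x => ?_
  have hx : (g • φ).1 (g • x) = φ.1 x := congrArg φ.1 (inv_smul_smul g x)
  rw [Set.mem_ofPred_eq, Set.mem_ofPred_eq, ← hx, mem_stabilizer_iff.1 hg]

end FiniteStabilizers

end GrigorchukCube

theorem theoremT_general (ω : ℕ → Fin 3) (hω : ∀ᶠ i in Filter.atTop, ω i ≠ ω (i + 1)) :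
    GrigorchukCube.IsModelEUnderline.{u} (GrigorchukCube.G ω) GrigorchukCube.X :=
  GrigorchukCube.isModelEUnderline_of_isConvexEmbedding (GrigorchukCube.isConvexEmbedding_toL2 ω)
    (GrigorchukCube.hasSeparatedOrbits ω) (GrigorchukCube.finite_stabilizer hω)

theorem theoremT (ω : ℕ → Fin 3) (hω : ∀ i, ω i ≠ ω (i + 1)) :
    GrigorchukCube.IsModelEUnderline.{u} (GrigorchukCube.G ω) GrigorchukCube.X :=
  theoremT_general ω (Filter.Eventually.of_forall hω)
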